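/- **Notation.** Let $\hat{\mathbb{Z}}=\varprojlim_n \mathbb{Z}/n$. For a prime $p$ let $e_0=X$; let $e_1=\frac{X+1}{2}$ if $p=2$ and $e_1=\frac{1}{p!}\prod_{a=1}^{(p-1)/2}(X^2-a^2)$ if $p\neq 2$; and for $j\ge 2$ let $$e_j=\frac{1}{(p^j)!}\prod_{0\le a\le \lfloor p^j/2\rfloor,\ (a,p)=1}(X^2-a^2).$$ Every integer $n\ge 0$ can be written uniquely as $n=a_0+\sum_{i\ge1}a_i\varphi(p^i)$ with $a_0\in\{0,\dots,p-2\}$ and $a_i\in\{0,\dots,p-1\}$ for $i\geq 1$; put $E^{(p)}_n=\prod_{j\ge0}e_j^{a_j}$. For $k\ge0$ put $C_p(k)=\prod_{j\ge0}(p^j!)^{a_j}$, where the $a_j$ are the digits of $n=2k$, and define integers $c^{(k,p)}_{2i}$ $(0\le i<k)$ by $$C_p(k)\,E^{(p)}_{2k}(X)=X^{2k}-\sum_{i=0}^{k-1}c^{(k,p)}_{2i}X^{2i}.$$ Let $S_k=\{p\text{ prime}: p-1\le 2k\}$ and $N_k=\prod_{p\in S_k}p^{\nu_p(C_p(k))}$.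 For $m\ge1$ let $\mathrm{Mom}^{(0)}_{\ge2m}$ be the set of integer sequences $(b_k)_{k\ge2m}$ with $b_{2k+1}=0$ for all $k\ge m$ such that for every prime $p$ there is a $\mathbb{Z}_p$-valued measure $\mu_p$ on $\mathbb{Z}_p^*/\{\pm1\}$ (that is, a $\mathbb{Z}_p$-linear map $C(\mathbb{Z}_p^*/\{\pm1\},\mathbb{Z}_p)\to\mathbb{Z}_p$) with $\int x^{2k}\,d\mu_p=b_{2k}$ for all $k\ge m$ and $\int 1\,d\mu_p=0$. **Theorem.** Let $m\ge1$. (1) Let $(b_k)_{k\ge2m}$ be an integer sequence with $b_{2k+1}=0$ for all $k\ge m$. Then $(b_k)_{k\geq 2m}\in\mathrm{Mom}^{(0)}_{\ge2m}$ if and only if there exist $b_0,\dots,b_{2m-1}\in\hat{\mathbb{Z}}$ with $b_0=0$, with $b_{2i+1}=0$ for $0\le i\le m-1$, and such that for all $k\ge1$ and all primes $p$ with $p-1\le2k$ $$b_{2k}\equiv\sum_{i=0}^{k-1}c^{(k,p)}_{2i}b_{2i}\pmod{p^{\nu_p(C_p(k))}\hat{\mathbb{Z}}}.$$ Such $b_0,\dots,b_{2m-1}$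 are uniquely determined by $(b_k)_{k\ge 2m}$ if they exist. (2) For $k\ge1$ and any $x_0,\dots,x_{k-1}\in\hat{\mathbb{Z}}$ there is a unique integer $b$ with $0\le b<N_k$ and $b\equiv\sum_{i=0}^{k-1}c^{(k,p)}_{2i}x_i \pmod{p^{\nu_p(C_p(k))}\hat{\mathbb{Z}}}$ for all $p\in S_k$; denote it by $r_k(x_0,\dots,x_{k-1})$. Given $l=(l_k)_{k\ge1}\in\hat{\mathbb{Z}}^{m-1}\times\mathbb{Z}^{\mathbb{N}_{\ge m}}$, that is, $l_k\in\hat{\mathbb{Z}}$ for $1\le k\le m-1$ and $l_k\in\mathbb{Z}$ for $k\ge m$, define recursively $b_0=0$ and, for $k\ge1$, $$b_{2k}=r_k(b_0,b_2,\dots,b_{2k-2})+l_k N_k,$$ which lies in $\mathbb{Z}$ for $k\ge m$, and put $b_{2k+1}=0$ for $k\geq 0$. Then $\Psi^{(0)}_m(l)=(b_k)_{k\ge2m}$ defines a bijection $$\Psi^{(0)}_m:\hat{\mathbb{Z}}^{m-1}\times\mathbb{Z}^{\mathbb{N}_{\ge m}}\to\mathrm{Mom}^{(0)}_{\ge2m}.$$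 This bijection is not additive. -/

import Mathlib

noncomputable section

namespace PMoment

open Polynomial

/-! ### The profinite integers -/

/-- The ring of profinite integers, as the inverse limit of the rings `ℤ/n` over `n ≥ 1`
ordered by divisibility. -/
def ZHat : Subring ((n : ℕ+) → ZMod n) where
  carrier := {x | ∀ (d n : ℕ+) (h : (d : ℕ) ∣ (n : ℕ)), ZMod.castHom h (ZMod d) (x n) = x d}
  mul_mem' hx hy d n h := by rw [Pi.mul_apply, Pi.mul_apply, map_mul, hx d n h, hy d n h]
  one_mem' d n h := by rw [Pi.one_apply, Pi.one_apply, map_one]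
  add_mem' hx hy d n h := by rw [Pi.add_apply, Pi.add_apply, map_add, hx d n h, hy d n h]
  zero_mem' d n h := by rw [Pi.zero_apply, Pi.zero_apply, map_zero]
  neg_mem' hx d n h := by rw [Pi.neg_apply, Pi.neg_apply, map_neg, hx d n h]

/-! ### The explicit polynomials -/

/-- The digits of the expansion `n = a₀ + ∑_{i ≥ 1} aᵢ φ(p ^ i)` with `0 ≤ a₀ ≤ p - 2` and
`0 ≤ aᵢ ≤ p - 1` for `i ≥ 1`. -/
def phiDigit (p n : ℕ) : ℕ → ℕ
  | 0 => n % (p - 1)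
  | i + 1 => n / (p - 1) / p ^ i % p

theorem phiDigit_zero_lt {p : ℕ} (hp : p.Prime) (n : ℕ) : phiDigit p n 0 < p - 1 :=
  Nat.mod_lt _ (Nat.sub_pos_of_lt hp.one_lt)

theorem phiDigit_lt {p : ℕ} (hp : p.Prime) (n i : ℕ) : phiDigit p n i < p := by
  cases i with
  | zero => exact (phiDigit_zero_lt hp n).trans_le (Nat.sub_le _ _)
  | succ i => exact Nat.mod_lt _ hp.pos

/-- The digits do give the expansion of `n`, and those of index larger than `n` play no role. -/
theorem phiDigit_expansion {p : ℕ} (hp : p.Prime) (n : ℕ) :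
    phiDigit p n 0 + ∑ i ∈ Finset.range n, phiDigit p n (i + 1) * (p ^ (i + 1)).totient = n := by
  have h1 : ∀ q N : ℕ, ∑ i ∈ Finset.range N, q / p ^ i % p * p ^ i = q % p ^ N := by
    intro q N
    induction N with
    | zero => simp [Nat.mod_one]
    | succ N ih => rw [Finset.sum_range_succ, ih, Nat.mod_pow_succ, mul_comm]
  have h2 : ∑ i ∈ Finset.range n, phiDigit p n (i + 1) * (p ^ (i + 1)).totient
      = (∑ i ∈ Finset.range n, n / (p - 1) / p ^ i % p * p ^ i) * (p - 1) := by
    rw [Finset.sum_mul]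
    refine Finset.sum_congr rfl fun i _ => ?_
    rw [Nat.totient_prime_pow_succ hp, phiDigit, mul_assoc]
  have h3 : n / (p - 1) < p ^ n :=
    (Nat.div_le_self _ _).trans_lt (Nat.lt_pow_self hp.one_lt)
  rw [h2, h1, Nat.mod_eq_of_lt h3, phiDigit]
  rw [mul_comm]
  exact Nat.mod_add_div n (p - 1)

/-- The basic polynomials `e_j` attached to the prime `p`. -/
def e (p : ℕ) : ℕ → ℚ[X]
  | 0 => X
  | 1 =>
    if p = 2 then C (1 / 2) * (X + 1)
    else C (1 / (p.factorial : ℚ)) * ∏ a ∈ Finset.Icc 1 ((p - 1) / 2), (X ^ 2 - C ((a : ℚ) ^ 2))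
  | j + 2 =>
    C (1 / ((p ^ (j + 2)).factorial : ℚ)) *
      ∏ a ∈ (Finset.range (p ^ (j + 2) / 2 + 1)).filter (fun a => a.Coprime p),
        (X ^ 2 - C ((a : ℚ) ^ 2))

/-- The polynomials `E_n = ∏_j e_j ^ {a_j}`, where the `a_j` are the digits of `n` as in
`phiDigit` (those of index larger than `n` vanish). -/
def E (p n : ℕ) : ℚ[X] := ∏ j ∈ Finset.range (n + 1), e p j ^ phiDigit p n j

/-- The number `C_p(k) = ∏_j (p ^ j)! ^ {a_j}`, with `a_j` the digits of `2k`; it is the inverse of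
the leading coefficient of `E_{2k}`. -/
def lead (p k : ℕ) : ℕ :=
  ∏ j ∈ Finset.range (2 * k + 1), (p ^ j).factorial ^ phiDigit p (2 * k) j

/-- The integers `c_{2i}^{(k,p)}` for `i < k`, given by
`C_p(k) E_{2k} = X ^ (2k) - ∑_{i < k} c_{2i}^{(k,p)} X ^ (2i)`
(the coefficients on the left are integers, see `lead_mul_E`). -/
def coef (k p i : ℕ) : ℤ := -((C (lead p k : ℚ) * E p (2 * k)).coeff (2 * i)).num

theorem two_mul_card_coprime {n : ℕ} (hn : 2 < n) :
    2 * ((Finset.range (n / 2 + 1)).filter (fun a => n.Coprime a)).card = n.totient := by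
  have h0 : ¬ n.Coprime 0 := by
    rw [Nat.coprime_zero_right]; omega
  have hhalf : ∀ a, n.Coprime a → n ≠ 2 * a := by
    intro a ha h
    have h1 : a ∣ n := ⟨2, by omega⟩
    have := Nat.eq_one_of_dvd_coprimes ha h1 dvd_rfl
    omega
  have hsub : ∀ a, a ≤ n → n.Coprime a → n.Coprime (n - a) := by
    intro a ha h
    exact (Nat.coprime_self_sub_right ha).2 h
  have hA : (Finset.range n).filter (fun a => n.Coprime a)
      = (Finset.range (n / 2 + 1)).filter (fun a => n.Coprime a) ∪
        (Finset.Ico (n / 2 + 1) n).filter (fun a => n.Coprime a) := by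
    rw [← Finset.filter_union]
    congr 1
    ext a
    simp only [Finset.mem_range, Finset.mem_union, Finset.mem_Ico]
    omega
  have hd : Disjoint ((Finset.range (n / 2 + 1)).filter (fun a => n.Coprime a))
      ((Finset.Ico (n / 2 + 1) n).filter (fun a => n.Coprime a)) := by
    rw [Finset.disjoint_left]
    intro a ha hb
    simp only [Finset.mem_filter, Finset.mem_range, Finset.mem_Ico] at ha hb
    omega
  have hc : ((Finset.range (n / 2 + 1)).filter (fun a => n.Coprime a)).card
      = ((Finset.Ico (n / 2 + 1) n).filter (fun a => n.Coprime a)).card := by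
    refine Finset.card_nbij' (fun a => n - a) (fun a => n - a) ?_ ?_ ?_ ?_
    · intro a ha
      simp only [Finset.coe_filter, Set.mem_ofPred_eq, Finset.mem_range, Finset.mem_Ico] at ha ⊢
      have h1 := hhalf a ha.2
      have h2 : a ≠ 0 := by rintro rfl; exact h0 ha.2
      exact ⟨by omega, hsub a (by omega) ha.2⟩
    · intro a ha
      simp only [Finset.coe_filter, Set.mem_ofPred_eq, Finset.mem_range, Finset.mem_Ico] at ha ⊢
      exact ⟨by omega, hsub a (by omega) ha.2⟩
    · intro a ha
      simp only [Finset.coe_filter, Set.mem_ofPred_eq, Finset.mem_range] at ha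
      show n - (n - a) = a
      omega
    · intro a ha
      simp only [Finset.coe_filter, Set.mem_ofPred_eq, Finset.mem_Ico] at ha
      show n - (n - a) = a
      omega
  rw [Nat.totient_eq_card_coprime, hA, Finset.card_union_of_disjoint hd, ← hc, two_mul]

theorem exists_prod_sq (s : Finset ℕ) :
    ∃ H : ℤ[X], H.Monic ∧ H.natDegree = s.card ∧
      ∏ a ∈ s, ((X : ℚ[X]) ^ 2 - C ((a : ℚ) ^ 2)) = (expand ℤ 2 H).map (Int.castRingHom ℚ) := by
  refine ⟨∏ a ∈ s, (X - C ((a : ℤ) ^ 2)), monic_prod_of_monic _ _ fun a _ => monic_X_sub_C _,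
    ?_, ?_⟩
  · rw [natDegree_prod_of_monic _ _ fun a _ => monic_X_sub_C _]
    simp only [natDegree_X_sub_C, Finset.sum_const, smul_eq_mul, mul_one]
  · rw [map_prod, Polynomial.map_prod]
    refine Finset.prod_congr rfl fun a _ => ?_
    simp

/-- Each factor of `C_p(k) E_{2k}` is an even monic integral polynomial of the expected degree. -/
theorem exists_factor {p : ℕ} (hp : p.Prime) (k j : ℕ) :
    ∃ H : ℤ[X], H.Monic ∧
      2 * H.natDegree = phiDigit p (2 * k) j * (if j = 0 then 1 else (p ^ j).totient) ∧
      C (((p ^ j).factorial : ℚ) ^ phiDigit p (2 * k) j) * e p j ^ phiDigit p (2 * k) j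
        = (expand ℤ 2 H).map (Int.castRingHom ℚ) := by
  have key : ∀ (d : ℕ) (s : Finset ℕ), d ≠ 0 → ∀ a t : ℕ, 2 * s.card = t →
      ∃ H : ℤ[X], H.Monic ∧ 2 * H.natDegree = a * t ∧
        C ((d : ℚ) ^ a) * (C (1 / (d : ℚ)) * ∏ b ∈ s, (X ^ 2 - C ((b : ℚ) ^ 2))) ^ a
          = (expand ℤ 2 H).map (Int.castRingHom ℚ) := by
    intro d s hd a t ht
    obtain ⟨H, hm, hdeg, hH⟩ := exists_prod_sq s
    refine ⟨H ^ a, hm.pow a, ?_, ?_⟩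
    · rw [hm.natDegree_pow, hdeg, ← ht]; ring
    · rw [C_pow, ← mul_pow, ← mul_assoc, ← C_mul, hH]
      have : (d : ℚ) * (1 / d) = 1 := by
        have : (d : ℚ) ≠ 0 := by exact_mod_cast hd
        field_simp
      rw [this, C_1, one_mul, map_pow, Polynomial.map_pow]
  match j with
  | 0 =>
    have hev : 2 ∣ phiDigit p (2 * k) 0 := by
      rcases hp.eq_two_or_odd' with rfl | ho
      · simp [phiDigit, Nat.mod_one]
      · have h2 : 2 ∣ p - 1 := by
          obtain ⟨r, rfl⟩ := ho
          exact ⟨r, by omega⟩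
        exact (Nat.dvd_mod_iff h2).2 ⟨k, rfl⟩
    obtain ⟨r, hr⟩ := hev
    refine ⟨X ^ r, monic_X_pow r, ?_, ?_⟩
    · simp [hr]
    · rw [hr]
      simp [e, pow_mul]
  | 1 =>
    by_cases h2 : p = 2
    · subst h2
      have h0 : phiDigit 2 (2 * k) 1 = 0 := by simp [phiDigit]
      refine ⟨1, monic_one, by simp [h0], by simp [h0]⟩
    · have h3 := key p.factorial (Finset.Icc 1 ((p - 1) / 2)) p.factorial_ne_zero
        (phiDigit p (2 * k) 1) (p ^ 1).totient (by
          rw [pow_one, Nat.totient_prime hp, Nat.card_Icc]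
          obtain ⟨r, hr⟩ := hp.odd_of_ne_two h2
          omega)
      simpa [e, h2] using h3
  | j + 2 =>
    have hs : (Finset.range (p ^ (j + 2) / 2 + 1)).filter (fun a => a.Coprime p)
        = (Finset.range (p ^ (j + 2) / 2 + 1)).filter (fun a => (p ^ (j + 2)).Coprime a) := by
      refine Finset.filter_congr fun a _ => ?_
      rw [Nat.coprime_pow_left_iff (by omega), Nat.coprime_comm]
    have hlt : 2 < p ^ (j + 2) := by
      have h1 : 2 ^ 2 ≤ p ^ 2 := Nat.pow_le_pow_left hp.two_le 2
      have h2 : p ^ 2 ≤ p ^ (j + 2) := Nat.pow_le_pow_right hp.pos (by omega)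
      omega
    have h3 := key (p ^ (j + 2)).factorial
      ((Finset.range (p ^ (j + 2) / 2 + 1)).filter (fun a => a.Coprime p))
      (Nat.factorial_ne_zero _) (phiDigit p (2 * k) (j + 2)) (p ^ (j + 2)).totient
      (by rw [hs]; exact two_mul_card_coprime hlt)
    simpa [e] using h3

/-- The identity that determines the integers `coef k p i`. -/
theorem lead_mul_E {p : ℕ} (hp : p.Prime) (k : ℕ) :
    C (lead p k : ℚ) * E p (2 * k)
      = X ^ (2 * k) - ∑ i ∈ Finset.range k, C (coef k p i : ℚ) * X ^ (2 * i) := by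
  choose H hm hdeg hH using exists_factor hp k
  set P : ℤ[X] := ∏ j ∈ Finset.range (2 * k + 1), H j with hP
  have hPm : P.Monic := monic_prod_of_monic _ _ fun j _ => hm j
  have hPd : P.natDegree = k := by
    have h1 : 2 * P.natDegree = 2 * k := by
      rw [hP, natDegree_prod_of_monic _ _ fun j _ => hm j, Finset.mul_sum,
        Finset.sum_congr rfl fun j _ => hdeg j, Finset.sum_range_succ', add_comm]
      simpa using phiDigit_expansion hp (2 * k)
    omega
  have hPE : C (lead p k : ℚ) * E p (2 * k) = (expand ℤ 2 P).map (Int.castRingHom ℚ) := by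
    rw [lead, E, Nat.cast_prod, map_prod C, ← Finset.prod_mul_distrib, hP, map_prod,
      Polynomial.map_prod]
    refine Finset.prod_congr rfl fun j _ => ?_
    rw [← hH j, Nat.cast_pow]
  have hc : ∀ i, coef k p i = -P.coeff i := by
    intro i
    rw [coef, hPE, coeff_map, mul_comm 2 i, coeff_expand_mul (by norm_num)]
    simp
  rw [hPE]
  conv_lhs => rw [hPm.as_sum, hPd]
  simp only [hc, map_add, map_sum, map_mul, expand_C, expand_X, map_pow, Polynomial.map_add,
    Polynomial.map_pow, Polynomial.map_sum, Polynomial.map_mul, map_X, map_C, Int.coe_castRingHom,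
    Int.cast_neg, map_neg, neg_mul, Finset.sum_neg_distrib, sub_neg_eq_add, pow_mul]

/-- The finite set `S_k` of primes `p` with `p - 1 ≤ 2k`. -/
def primesUpTo (k : ℕ) : Finset ℕ :=
  (Finset.range (2 * k + 2)).filter (fun p => p.Prime ∧ p - 1 ≤ 2 * k)

theorem mem_primesUpTo {k p : ℕ} : p ∈ primesUpTo k ↔ p.Prime ∧ p - 1 ≤ 2 * k := by
  rw [primesUpTo, Finset.mem_filter, Finset.mem_range]
  constructor
  · exact fun h => h.2
  · exact fun h => ⟨by omega, h⟩

/-- The modulus `∏_{p ∈ S_k} p ^ {ν_p(C_p(k))}`. -/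
def modulus (k : ℕ) : ℕ := ∏ p ∈ primesUpTo k, p ^ padicValNat p (lead p k)

/-! ### Measures and moment sequences -/

/-- The profinite group `ℤ_p^* / {± 1}`. -/
abbrev UnitsModSign (p : ℕ) [Fact p.Prime] : Type :=
  ℤ_[p]ˣ ⧸ Subgroup.zpowers (-1 : ℤ_[p]ˣ)

/-- The group `ℤ_p`-valued measures on `ℤ_p^* / {± 1}`: the `ℤ_p`-linear maps
`C(ℤ_p^* / {± 1}, ℤ_p) → ℤ_p`. -/
abbrev Meas (p : ℕ) [Fact p.Prime] : Type :=
  C(UnitsModSign p, ℤ_[p]) →ₗ[ℤ_[p]] ℤ_[p]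

/-- The continuous function `x ↦ x ^ (2k)` on `ℤ_p^* / {± 1}`. -/
def evenPow (p : ℕ) [Fact p.Prime] (k : ℕ) : C(UnitsModSign p, ℤ_[p]) where
  toFun := Quotient.lift (fun x : ℤ_[p]ˣ => (x : ℤ_[p]) ^ (2 * k)) (by
    intro x y hxy
    have h := QuotientGroup.leftRel_apply.1 hxy
    obtain ⟨n, hn⟩ := Subgroup.mem_zpowers_iff.1 h
    have hy : y = x * (-1) ^ n := by rw [hn]; group
    show (x : ℤ_[p]) ^ (2 * k) = (y : ℤ_[p]) ^ (2 * k)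
    rcases Int.even_or_odd n with he | ho
    · rw [hy, he.neg_one_zpow, mul_one]
    · rw [hy, ho.neg_one_zpow]
      simp [pow_mul])
  continuous_toFun := Continuous.quotient_lift
    (Units.continuous_val.pow (2 * k)) _

/-- `Mom m` is the set of the integer sequences `(b_k)_{k ≥ 2m}` with `b_{2k+1} = 0` for `k ≥ m`
such that, for every prime `p`, some `ℤ_p`-valued measure on `ℤ_p^* / {± 1}` of total mass zero
has the moments `∫ x ^ (2k) = b_{2k}` for all `k ≥ m`. -/
def Mom (m : ℕ) : Set (Set.Ici (2 * m) → ℤ) :=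
  {b | (∀ (k : ℕ) (hk : m ≤ k), b ⟨2 * k + 1, Set.mem_Ici.2 (by omega)⟩ = 0) ∧
    ∀ (p : ℕ) [Fact p.Prime], ∃ μ : Meas p,
      (∀ (k : ℕ) (hk : m ≤ k),
        (b ⟨2 * k, Set.mem_Ici.2 (by omega)⟩ : ℤ_[p]) = μ (evenPow p k)) ∧
      μ 1 = 0}

/-! ### The recursive congruences -/

/-- The sequence `(b_k)_{k ≥ 0}` in the profinite integers with the first `2m` terms given by `a`
and the others by the integers `b`. -/
def extendSeq (m : ℕ) (a : Fin (2 * m) → ZHat) (b : Set.Ici (2 * m) → ℤ) (k : ℕ) : ZHat :=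
  if h : k < 2 * m then a ⟨k, h⟩ else (b ⟨k, Set.mem_Ici.2 (not_lt.1 h)⟩ : ZHat)

/-- The system of congruences in the profinite integers for a sequence `(x_k)_{k ≥ 0}`: for all
`k ≥ 1` and all primes `p` with `p - 1 ≤ 2k`, the term `x_{2k}` is congruent to
`∑_{i < k} c_{2i}^{(k,p)} x_{2i}` modulo `p ^ {ν_p(C_p(k))}`. -/
def Congruences (x : ℕ → ZHat) : Prop :=
  ∀ k : ℕ, 1 ≤ k → ∀ p : ℕ, p.Prime → p - 1 ≤ 2 * k →
    ((p ^ padicValNat p (lead p k) : ℕ) : ZHat) ∣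
      x (2 * k) - ∑ i ∈ Finset.range k, (coef k p i : ZHat) * x (2 * i)

/-- `a` is an admissible family of terms `b_0, …, b_{2m-1}` below the integer sequence `b`. -/
def IsLowerPart (m : ℕ) (b : Set.Ici (2 * m) → ℤ) (a : Fin (2 * m) → ZHat) : Prop :=
  (∀ h : 0 < 2 * m, a ⟨0, h⟩ = 0) ∧
    (∀ (i : ℕ) (h : i < m), a ⟨2 * i + 1, by omega⟩ = 0) ∧
    Congruences (extendSeq m a b)

/-! ### The explicit map -/

/-- The parameters: `l_i` is a profinite integer for `1 ≤ i ≤ m - 1` and an integer for `i ≥ m`. -/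
abbrev Param (m : ℕ) : Type := (Set.Ico 1 m → ZHat) × (Set.Ici m → ℤ)

/-- `b` is a natural number below the modulus that satisfies the congruences
`b ≡ ∑_{i < k} c_{2i}^{(k,p)} x_i` modulo `p ^ {ν_p(C_p(k))}` for all `p ∈ S_k`; here `x_i` stands
for the term of index `2i`. -/
def IsResidue (k : ℕ) (x : Fin k → ZHat) (b : ℕ) : Prop :=
  b < modulus k ∧ ∀ p ∈ primesUpTo k,
    ((p ^ padicValNat p (lead p k) : ℕ) : ZHat) ∣
      (b : ZHat) - ∑ i : Fin k, (coef k p i : ZHat) * x i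

/-- The unique natural number `b` with `IsResidue k x b`. -/
def residue (k : ℕ) (x : Fin k → ZHat) : ℕ := sInf {b : ℕ | IsResidue k x b}

/-- The term `b_{2k}` of the sequence built from the parameters `l`: `b_0 = 0` and, for `k ≥ 1`,
`b_{2k} = b + l_k ∏_{p ∈ S_k} p ^ {ν_p(C_p(k))}` with `b` the residue determined by the terms
`b_{2i}` for `i < k`. -/
def evenTerm (m : ℕ) (l : Param m) (k : ℕ) : ZHat :=
  if hk : 1 ≤ k then
    (residue k (fun i : Fin k => evenTerm m l i) : ZHat) +
      (if h : k < m then l.1 ⟨k, hk, h⟩ else (l.2 ⟨k, Set.mem_Ici.2 (not_lt.1 h)⟩ : ZHat)) *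
        (modulus k : ZHat)
  else 0
termination_by k
decreasing_by exact i.2

/-- The integer sequence `(b_k)_{k ≥ 2m}` built from the parameters `l`; for `k ≥ m ≥ 1` the
integer `b_{2k} = b + l_k ∏_{p ∈ S_k} p ^ {ν_p(C_p(k))}` is the term `evenTerm m l k`. -/
def Psi (m : ℕ) (l : Param m) (n : Set.Ici (2 * m)) : ℤ :=
  if Even n.1 then
    (residue (n.1 / 2) (fun i => evenTerm m l i) : ℤ) +
      l.2 ⟨n.1 / 2, Set.mem_Ici.2 (by have := Set.mem_Ici.1 n.2; omega)⟩ * (modulus (n.1 / 2) : ℤ)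
  else 0

/-- `Psi m l` consists of the terms of index at least `2m` of the recursive sequence. -/
theorem Psi_even_cast {m : ℕ} (hm : 1 ≤ m) (l : Param m) (k : ℕ) (hk : m ≤ k) :
    (Psi m l ⟨2 * k, Set.mem_Ici.2 (by omega)⟩ : ZHat) = evenTerm m l k := by
  have h2 : ∀ j (hj : j = k) (h : m ≤ j),
      ((residue j (fun i => evenTerm m l i) : ℤ) +
        l.2 ⟨j, Set.mem_Ici.2 h⟩ * (modulus j : ℤ) : ℤ) =
      (residue k (fun i => evenTerm m l i) : ℤ) +
        l.2 ⟨k, Set.mem_Ici.2 hk⟩ * (modulus k : ℤ) := by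
    rintro j rfl h
    rfl
  rw [Psi, if_pos (even_two_mul k), h2 _ (by simp) (by simpa using hk), evenTerm,
    dif_pos (hm.trans hk), dif_neg (not_lt.2 hk)]
  push_cast
  rfl

end PMoment

end

noncomputable section

namespace PMoment

open Polynomial

/-! ### Divisibility and components of profinite integers -/

/-! Everything rests on a theorem of Mahler type: for each prime `p` the functions `E_{2k}` are
integral on `ℤ_p^* / {± 1}`, and modulo `p` those with `2k < φ(p ^ (i + 1))` form a basis of the
even functions on the units modulo `p ^ (i + 1)`. Indeed, on units `e_{j+1}` is a binomial
coefficient divided by a unit, so by Lucas' congruence its reduction separates the `p` lifts of a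
class modulo `p ^ (j + 1)` to classes modulo `p ^ (j + 2)` (`eMod_eq_iff`). The digit expansion of
`2k` makes `E_{2k}` a product of powers below `p` of such coordinates, and induction on the level
gives independence (`eq_zero_of_sum_EMod_eq_zero`) and spanning (`exists_sum_EMod_eq`).

Hence the integrals of the `E_{2k}` against a measure can be prescribed arbitrarily in `ℤ_p`
(`exists_extension`, `exists_meas_EFun`). Since `C_p(k) E_{2k} = x ^ (2k) - ∑ c_{2i} x ^ (2i)`, a
sequence consists of moments exactly when `C_p(k)` divides the corresponding combination for every
`k`, which is the system of congruences (`isMomentSeq_iff_congruences`).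

The missing lower terms are forced: `x ^ (2mφ(n))` is congruent to `1` modulo the prime powers
dividing `n`, so `b_{2i}` must be `b_{2(i + mφ(n))}` modulo `n`. These residues are compatible and
define a profinite integer (`exists_isMomentSeq`, `isLowerPart_unique`).

For the bijection, the Chinese remainder theorem fixes `b_{2k}` modulo `N_k` from the preceding
terms, and `l_k` is the remaining quotient. Additivity fails because residues are never negative: it
would produce a sequence with a positive term at `2m` and zeros at all later even indices, against
the congruences modulo every `n`. -/

theorem ZHat.ext {x y : ZHat} (h : ∀ n : ℕ+, x.1 n = y.1 n) : x = y :=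
  Subtype.ext (funext h)

/-- The component of index `n`, as a ring homomorphism. -/
def ZHat.comp (n : ℕ+) : ZHat →+* ZMod n :=
  (Pi.evalRingHom (fun n : ℕ+ => ZMod n) n).comp ZHat.subtype

theorem ZHat.comp_apply (n : ℕ+) (x : ZHat) : ZHat.comp n x = x.1 n := rfl

theorem ZHat.castHom_comp {d n : ℕ+} (h : (d : ℕ) ∣ n) (x : ZHat) :
    ZMod.castHom h (ZMod d) (ZHat.comp n x) = ZHat.comp d x := x.2 d n h

/-- A profinite integer is divisible by `n` as soon as its component of index `n` vanishes. -/
theorem ZHat.natCast_dvd_iff (n : ℕ+) (x : ZHat) : ((n : ℕ) : ZHat) ∣ x ↔ ZHat.comp n x = 0 := by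
  constructor
  · rintro ⟨y, rfl⟩
    simp
  · intro h
    have hd : ∀ k : ℕ+, (n : ℕ) ∣ (ZHat.comp (n * k) x).val := by
      intro k
      have h1 := ZHat.castHom_comp (d := n) (n := n * k) (by simp) x
      rw [h, ← ZMod.natCast_zmod_val (ZHat.comp (n * k) x), map_natCast,
        ZMod.natCast_eq_zero_iff] at h1
      exact h1
    choose z hz using hd
    -- The quotient at level `k` is read off at level `n * k`, where the representative is `n * z
    -- k`; dividing by `n` leaves `z k` well defined modulo `k`.
    refine ⟨⟨fun k => (z k : ZMod k), ?_⟩, ?_⟩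
    · intro d k hdk
      have h1 := ZHat.castHom_comp (d := n * d) (n := n * k)
        (by simpa using Nat.mul_dvd_mul_left _ hdk) x
      rw [← ZMod.natCast_zmod_val (ZHat.comp (n * k) x), map_natCast,
        ← ZMod.natCast_zmod_val (ZHat.comp (n * d) x), hz, hz, ZMod.natCast_eq_natCast_iff] at h1
      rw [map_natCast, ZMod.natCast_eq_natCast_iff]
      exact Nat.ModEq.mul_left_cancel' n.ne_zero (by simpa using h1)
    · refine ZHat.ext fun k => ?_
      have h1 := ZHat.castHom_comp (d := k) (n := n * k) (by simp) x
      rw [← ZMod.natCast_zmod_val (ZHat.comp (n * k) x), map_natCast, hz] at h1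
      rw [← ZHat.comp_apply, ← h1]
      change _ = ZHat.comp k ((n : ℕ) : ZHat) * (z k : ZMod k)
      simp

/-- If `n` kills the component at level `n * k`, its representative is a multiple of `k`, and it
reduces to the component at level `k`. -/
theorem ZHat.eq_zero_of_natCast_mul {n : ℕ} (hn : n ≠ 0) {x : ZHat} (h : (n : ZHat) * x = 0) :
    x = 0 := by
  refine ZHat.ext fun k => ?_
  let N : ℕ+ := ⟨n, Nat.pos_of_ne_zero hn⟩
  have h1 := congrArg (ZHat.comp (N * k)) h
  rw [map_mul, map_natCast, map_zero, ← ZMod.natCast_zmod_val (ZHat.comp (N * k) x),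
    ← Nat.cast_mul, ZMod.natCast_eq_zero_iff] at h1
  have h2 : (k : ℕ) ∣ (ZHat.comp (N * k) x).val :=
    Nat.dvd_of_mul_dvd_mul_left N.pos (by rwa [← PNat.mul_coe])
  have h3 := ZHat.castHom_comp (d := k) (n := N * k) (by simp) x
  rw [← ZMod.natCast_zmod_val (ZHat.comp (N * k) x), map_natCast,
    (ZMod.natCast_eq_zero_iff _ _).2 h2] at h3
  exact h3.symm

theorem ZHat.intCast_dvd_intCast {n : ℕ+} {z : ℤ} (h : ((n : ℕ) : ZHat) ∣ (z : ZHat)) :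
    ((n : ℕ) : ℤ) ∣ z := by
  rw [ZHat.natCast_dvd_iff, map_intCast] at h
  exact (ZMod.intCast_zmod_eq_zero_iff_dvd z n).1 h

/-- The prime power `p ^ n` as a positive natural number. -/
def primePow (p : ℕ) [hp : Fact p.Prime] (n : ℕ) : ℕ+ := ⟨p ^ n, pow_pos hp.out.pos n⟩

/-- The projection from the profinite integers to the `p`-adic integers. -/
def ZHat.toPadicInt (p : ℕ) [Fact p.Prime] : ZHat →+* ℤ_[p] :=
  PadicInt.lift (f := fun n => (ZHat.comp (primePow p n) : ZHat →+* ZMod (p ^ n)))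
    (fun _ _ h => RingHom.ext fun x =>
      ZHat.castHom_comp (d := primePow p _) (n := primePow p _) (pow_dvd_pow p h) x)

theorem ZHat.toZModPow_toPadicInt (p : ℕ) [Fact p.Prime] (n : ℕ) (x : ZHat) :
    PadicInt.toZModPow n (ZHat.toPadicInt p x) = ZHat.comp (primePow p n) x :=
  DFunLike.congr_fun (PadicInt.lift_spec
    (f := fun n => (ZHat.comp (primePow p n) : ZHat →+* ZMod (p ^ n))) _ n) x

theorem toZModPow_eq_zero_iff {p : ℕ} [Fact p.Prime] (n : ℕ) (x : ℤ_[p]) :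
    PadicInt.toZModPow n x = 0 ↔ (p : ℤ_[p]) ^ n ∣ x := by
  rw [← RingHom.mem_ker, PadicInt.ker_toZModPow, Ideal.mem_span_singleton]

theorem ZHat.pow_dvd_iff (p : ℕ) [Fact p.Prime] (n : ℕ) (x : ZHat) :
    ((p ^ n : ℕ) : ZHat) ∣ x ↔ (p : ℤ_[p]) ^ n ∣ ZHat.toPadicInt p x := by
  rw [← toZModPow_eq_zero_iff, ZHat.toZModPow_toPadicInt]
  exact ZHat.natCast_dvd_iff (primePow p n) x

/-! ### Residues -/

theorem modulus_pos (k : ℕ) : 0 < modulus k :=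
  Finset.prod_pos fun _ hp => pow_pos (mem_primesUpTo.1 hp).1.pos _

theorem coprime_primesUpTo (k : ℕ) : Set.Pairwise (primesUpTo k : Set ℕ)
    (Function.onFun Nat.Coprime fun p => p ^ padicValNat p (lead p k)) := by
  intro p hp q hq hpq
  exact Nat.Coprime.pow _ _ ((Nat.coprime_primes (mem_primesUpTo.1 hp).1
    (mem_primesUpTo.1 hq).1).2 hpq)

theorem modulus_dvd {k : ℕ} {x : ZHat} (h : ∀ p ∈ primesUpTo k,
    ((p ^ padicValNat p (lead p k) : ℕ) : ZHat) ∣ x) : ((modulus k : ℕ) : ZHat) ∣ x := by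
  rw [modulus, Nat.cast_prod]
  refine Finset.prod_dvd_of_coprime (fun p hp q hq hpq => ?_) h
  exact (coprime_primesUpTo k hp hq hpq).cast

theorem pow_dvd_modulus {k p : ℕ} (hp : p ∈ primesUpTo k) :
    p ^ padicValNat p (lead p k) ∣ modulus k :=
  Finset.dvd_prod_of_mem (fun p => p ^ padicValNat p (lead p k)) hp

/-- Each profinite sum can be replaced by a natural number `a p` representing it modulo the prime
power; the Chinese remainder theorem does the rest. -/
theorem existsUnique_isResidue (k : ℕ) (x : Fin k → ZHat) : ∃! r : ℕ, IsResidue k x r := by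
  set s : ℕ → ℕ := fun p => p ^ padicValNat p (lead p k) with hs
  have hs0 : ∀ p ∈ primesUpTo k, s p ≠ 0 := fun p hp =>
    pow_ne_zero _ (mem_primesUpTo.1 hp).1.ne_zero
  have ha : ∀ p, ∃ a : ℕ, p ∈ primesUpTo k →
      (s p : ZHat) ∣ (a : ZHat) - ∑ i : Fin k, (coef k p i : ZHat) * x i := by
    intro p
    by_cases hp : p ∈ primesUpTo k
    · let n : ℕ+ := ⟨s p, Nat.pos_of_ne_zero (hs0 p hp)⟩
      refine ⟨(ZHat.comp n (∑ i : Fin k, (coef k p i : ZHat) * x i)).val, fun _ => ?_⟩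
      refine (ZHat.natCast_dvd_iff n _).2 ?_
      rw [map_sub, map_natCast, ZMod.natCast_zmod_val, sub_self]
    · exact ⟨0, fun h => absurd h hp⟩
  choose a ha using ha
  have key : ∀ r : ℕ, (∀ p ∈ primesUpTo k, (s p : ZHat) ∣
      (r : ZHat) - ∑ i : Fin k, (coef k p i : ZHat) * x i) ↔
      ∀ p ∈ primesUpTo k, r ≡ a p [MOD s p] := by
    intro r
    refine forall₂_congr fun p hp => ?_
    let n : ℕ+ := ⟨s p, Nat.pos_of_ne_zero (hs0 p hp)⟩
    have h1 := (ZHat.natCast_dvd_iff n _).1 (ha p hp)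
    refine (ZHat.natCast_dvd_iff n _).trans ?_
    rw [map_sub, sub_eq_zero] at h1 ⊢
    rw [← h1, map_natCast, map_natCast]
    exact ZMod.natCast_eq_natCast_iff _ _ _
  have hlt := Nat.chineseRemainderOfFinset_lt_prod a s hs0 (coprime_primesUpTo k)
  have hr2 := (Nat.chineseRemainderOfFinset a s (primesUpTo k) hs0 (coprime_primesUpTo k)).2
  refine ⟨_, ⟨hlt, (key _).2 hr2⟩, ?_⟩
  rintro y ⟨hy, hy2⟩
  refine Nat.ModEq.eq_of_lt_of_lt ?_ hy hlt
  have h3 : ∀ p ∈ primesUpTo k, y ≡ Nat.chineseRemainderOfFinset a s (primesUpTo k) hs0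
    (coprime_primesUpTo k) [MOD s p] := fun p hp =>
      ((key y).1 hy2 p hp).trans (hr2 p hp).symm
  rw [Nat.modEq_iff_dvd, modulus, Nat.cast_prod]
  refine Finset.prod_dvd_of_coprime (fun p hp q hq hpq => ?_) fun p hp =>
    Nat.modEq_iff_dvd.1 (h3 p hp)
  exact (coprime_primesUpTo k hp hq hpq).isCoprime

theorem residue_spec (k : ℕ) (x : Fin k → ZHat) : IsResidue k x (residue k x) :=
  Nat.sInf_mem (existsUnique_isResidue k x).exists

theorem lead_ne_zero (p k : ℕ) : lead p k ≠ 0 :=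
  Finset.prod_ne_zero_iff.2 fun _ _ => pow_ne_zero _ (Nat.factorial_ne_zero _)

theorem lead_eq_one {p k : ℕ} (h : 2 * k < p - 1) : lead p k = 1 := by
  refine Finset.prod_eq_one fun j _ => ?_
  cases j with
  | zero => simp
  | succ i => rw [phiDigit, Nat.div_eq_of_lt h, Nat.zero_div, Nat.zero_mod, pow_zero]

variable {p : ℕ} [hpf : Fact p.Prime]

/-! ### Reduction of `p`-adic integers -/

theorem toZMod_eq_iff (a b : ℤ_[p]) :
    PadicInt.toZMod a = PadicInt.toZMod b ↔ (p : ℤ_[p]) ∣ a - b := by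
  rw [← sub_eq_zero, ← map_sub, ← RingHom.mem_ker, PadicInt.ker_toZMod,
    PadicInt.maximalIdeal_eq_span_p, Ideal.mem_span_singleton]

theorem isOpen_setOf_pow_dvd (n : ℕ) : IsOpen {w : ℤ_[p] | (p : ℤ_[p]) ^ n ∣ w} := by
  have h : {w : ℤ_[p] | (p : ℤ_[p]) ^ n ∣ w} = Metric.closedBall 0 ((p : ℝ) ^ (-n : ℤ)) := by
    ext w
    rw [Set.mem_ofPred_eq, mem_closedBall_zero_iff, PadicInt.norm_le_pow_iff_mem_span_pow,
      Ideal.mem_span_singleton]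
  rw [h]
  refine IsUltrametricDist.isOpen_closedBall _ (zpow_ne_zero _ ?_)
  exact_mod_cast (Fact.out : p.Prime).ne_zero

theorem pow_dvd_natCast_sub_iff (n a b : ℕ) :
    (p : ℤ_[p]) ^ n ∣ (a : ℤ_[p]) - b ↔ a ≡ b [MOD p ^ n] := by
  rw [← Nat.ModEq.comm, Nat.modEq_iff_dvd, Nat.cast_pow, ← PadicInt.pow_p_dvd_int_iff]
  push_cast
  rfl

/-! ### Binomial coefficients -/

/-- Density of `ℕ` in `ℤ_p` and continuity of the binomial coefficient reduce questions modulo `p`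
to natural numbers. -/
theorem exists_natCast_choose_approx (N n : ℕ) (z : ℤ_[p]) :
    ∃ a : ℕ, (p : ℤ_[p]) ^ n ∣ z - a ∧
      PadicInt.toZMod (Ring.choose z N) = PadicInt.toZMod (Ring.choose (a : ℤ_[p]) N) := by
  have ho : IsOpen {w : ℤ_[p] | (p : ℤ_[p]) ^ n ∣ z - w ∧
      (p : ℤ_[p]) ^ 1 ∣ Ring.choose z N - Ring.choose w N} := by
    refine IsOpen.inter ((isOpen_setOf_pow_dvd n).preimage (continuous_const.sub continuous_id))
      ((isOpen_setOf_pow_dvd 1).preimage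
        (continuous_const.sub (PadicInt.continuous_choose N)))
  obtain ⟨a, h1, h2⟩ := PadicInt.denseRange_natCast.exists_mem_open ho ⟨z, by simp⟩
  exact ⟨a, h1, (toZMod_eq_iff _ _).2 (by simpa using h2)⟩

/-- Lucas' congruence: the digits of `p ^ j` below index `j` vanish, so their factors are `1` and
only the quotient by `p ^ j` survives. -/
theorem toZMod_choose_natCast (j a : ℕ) :
    PadicInt.toZMod (Ring.choose (a : ℤ_[p]) (p ^ j)) = ((a / p ^ j : ℕ) : ZMod p) := by
  have hp : p.Prime := Fact.out
  rw [Ring.choose_natCast, map_natCast]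
  have h := Choose.choose_modEq_choose_mul_prod_range_choose (p := p) (n := a) (k := p ^ j) j
  rw [Nat.div_self (pow_pos hp.pos j), Nat.choose_one_right, Finset.prod_eq_one,
    Nat.cast_one, mul_one] at h
  · have := (ZMod.intCast_eq_intCast_iff _ _ _).2 h
    exact_mod_cast this
  · intro i hi
    have hi := Finset.mem_range.1 hi
    obtain ⟨d, rfl⟩ := Nat.exists_eq_add_of_lt hi
    have h1 : p ^ (i + d + 1) / p ^ i = p ^ d * p := by
      rw [add_assoc, pow_add, Nat.mul_div_cancel_left _ (pow_pos hp.pos i), pow_succ]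
    simp [h1]

/-- The reduction of `z ↦ z.choose (p ^ j)` detects the digit of index `j`. -/
theorem toZMod_choose_eq_iff {j : ℕ} {z w : ℤ_[p]} (h : (p : ℤ_[p]) ^ j ∣ z - w) :
    PadicInt.toZMod (Ring.choose z (p ^ j)) = PadicInt.toZMod (Ring.choose w (p ^ j)) ↔
      (p : ℤ_[p]) ^ (j + 1) ∣ z - w := by
  have hp : p.Prime := Fact.out
  obtain ⟨a, ha, ha'⟩ := exists_natCast_choose_approx (p ^ j) (j + 1) z
  obtain ⟨b, hb, hb'⟩ := exists_natCast_choose_approx (p ^ j) (j + 1) w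
  have hab : (p : ℤ_[p]) ^ (j + 1) ∣ z - w ↔ (p : ℤ_[p]) ^ (j + 1) ∣ (a : ℤ_[p]) - b := by
    have h1 : z - w = ((a : ℤ_[p]) - b) + ((z - a) - (w - b)) := by ring
    rw [h1]
    exact (dvd_add_left (dvd_sub ha hb))
  have hab' : (p : ℤ_[p]) ^ j ∣ (a : ℤ_[p]) - b := by
    have h1 : (a : ℤ_[p]) - b = (z - w) - ((z - a) - (w - b)) := by ring
    rw [h1]
    have h2 : (p : ℤ_[p]) ^ j ∣ (p : ℤ_[p]) ^ (j + 1) := pow_dvd_pow _ (Nat.le_succ j)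
    exact dvd_sub h (dvd_sub (h2.trans ha) (h2.trans hb))
  rw [ha', hb', hab, toZMod_choose_natCast, toZMod_choose_natCast, pow_dvd_natCast_sub_iff,
    ZMod.natCast_eq_natCast_iff]
  rw [pow_dvd_natCast_sub_iff] at hab'
  constructor
  · intro h3
    rw [← Nat.div_add_mod a (p ^ j), ← Nat.div_add_mod b (p ^ j), hab', pow_succ]
    exact (h3.mul_left' _).add_right _
  · intro h3
    rw [← Nat.div_add_mod a (p ^ j), ← Nat.div_add_mod b (p ^ j), hab', pow_succ] at h3
    exact Nat.ModEq.mul_left_cancel' (pow_ne_zero _ hp.ne_zero) (h3.add_right_cancel' _)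

theorem prod_range_sub_natCast (z : ℤ_[p]) (N : ℕ) :
    ∏ s ∈ Finset.range N, (z - s) = (N.factorial : ℤ_[p]) * Ring.choose z N := by
  rw [← descPochhammer_eval_eq_prod_range, ← nsmul_eq_mul,
    ← Ring.descPochhammer_eq_factorial_smul_choose, descPochhammer_smeval_eq_ascPochhammer,
    descPochhammer_eval_eq_ascPochhammer, ascPochhammer_smeval_eq_eval]

/-! ### The values of the basic polynomials -/

/-- The product of the factors `x - w` over the multiples `w` of `p` in an interval of length `N`
centered at zero. -/
def unitPart (N : ℕ) (x : ℤ_[p]) : ℤ_[p] :=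
  ∏ s ∈ (Finset.range N).filter (fun s : ℕ => (p : ℤ) ∣ (s : ℤ) - (N / 2 : ℕ)),
    (x + (N / 2 : ℕ) - s)

theorem natCast_dvd_of_intCast_dvd {w : ℤ} (h : (p : ℤ) ∣ w) : (p : ℤ_[p]) ∣ (w : ℤ_[p]) := by
  obtain ⟨c, rfl⟩ := h
  exact ⟨c, by push_cast; rfl⟩

/-- Every `w` in the product is a multiple of `p`, so each factor is `x` modulo `p`. Thus `unitPart`
is invertible at units and modulo `p` depends only on `x` modulo `p`. -/
theorem toZMod_unitPart (N : ℕ) (x : ℤ_[p]) : PadicInt.toZMod (unitPart N x) =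
    ∏ _s ∈ (Finset.range N).filter (fun s : ℕ => (p : ℤ) ∣ (s : ℤ) - (N / 2 : ℕ)),
      PadicInt.toZMod x := by
  rw [unitPart, map_prod]
  refine Finset.prod_congr rfl fun s hs => ?_
  rw [toZMod_eq_iff]
  have h := natCast_dvd_of_intCast_dvd (Finset.mem_filter.1 hs).2
  have h1 : x + (N / 2 : ℕ) - s - x = -(((s : ℤ) - (N / 2 : ℕ) : ℤ) : ℤ_[p]) := by
    rw [Int.cast_sub, Int.cast_natCast, Int.cast_natCast]
    ring
  rw [h1]
  exact (dvd_neg).2 h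

theorem toZMod_unit_ne_zero (x : ℤ_[p]ˣ) : PadicInt.toZMod (x : ℤ_[p]) ≠ 0 :=
  (x.isUnit.map PadicInt.toZMod).ne_zero

theorem isUnit_iff_toZMod_ne_zero (x : ℤ_[p]) : IsUnit x ↔ PadicInt.toZMod x ≠ 0 := by
  rw [ne_eq, ← RingHom.mem_ker, PadicInt.ker_toZMod, IsLocalRing.mem_maximalIdeal, mem_nonunits_iff,
    not_not]

theorem isUnit_unitPart (N : ℕ) (x : ℤ_[p]ˣ) : IsUnit (unitPart N (x : ℤ_[p])) := by
  rw [isUnit_iff_toZMod_ne_zero, toZMod_unitPart, Finset.prod_ne_zero_iff]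
  exact fun _ _ => toZMod_unit_ne_zero x

/-- The value of `e p j` at a `p`-adic unit. -/
def eVal : ℕ → ℤ_[p]ˣ → ℤ_[p]
  | 0, x => x
  | j + 1, x => Ring.choose ((x : ℤ_[p]) + (p ^ (j + 1) / 2 : ℕ)) (p ^ (j + 1)) *
      Ring.inverse (unitPart (p ^ (j + 1)) (x : ℤ_[p]))

/-- This justifies the formula for `eVal`: with `N = p ^ (j + 1)`, the binomial coefficient times
`N!` is the product of `x - w` over `N` consecutive integers around zero, and dividing by `unitPart`
strikes out the multiples of `p`. -/
theorem factorial_mul_eVal (j : ℕ) (x : ℤ_[p]ˣ) :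
    ((p ^ (j + 1)).factorial : ℤ_[p]) * eVal (j + 1) x =
      ∏ s ∈ Finset.range (p ^ (j + 1)),
        if (p : ℤ) ∣ (s : ℤ) - (p ^ (j + 1) / 2 : ℕ) then 1
        else ((x : ℤ_[p]) - (((s : ℤ) - (p ^ (j + 1) / 2 : ℕ) : ℤ) : ℤ_[p])) := by
  rw [eVal, ← mul_assoc, ← prod_range_sub_natCast,
    ← Finset.prod_filter_mul_prod_filter_not (Finset.range (p ^ (j + 1)))
      (fun s : ℕ => (p : ℤ) ∣ (s : ℤ) - (p ^ (j + 1) / 2 : ℕ))]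
  rw [mul_comm (∏ s ∈ _, _), mul_assoc]
  have h := Ring.mul_inverse_cancel _ (isUnit_unitPart (p ^ (j + 1)) x)
  nth_rewrite 1 [unitPart] at h
  rw [h, mul_one, Finset.prod_filter]
  refine Finset.prod_congr rfl fun s _ => ?_
  by_cases hs : (p : ℤ) ∣ (s : ℤ) - (p ^ (j + 1) / 2 : ℕ)
  · rw [if_neg (not_not.2 hs), if_pos hs]
  · rw [if_pos hs, if_neg hs, Int.cast_sub, Int.cast_natCast, Int.cast_natCast]
    ring

/-- Pairs `w` with `-w`. The interval is symmetric for odd `N` but lacks its right end `N / 2` for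
even `N`; `hN` makes that factor harmless, and `h0` permits zero to be counted twice. -/
theorem prod_range_centered {M : Type*} [CommMonoid M] (F : ℤ → M) (h0 : F 0 = 1) {N : ℕ}
    (hN : Even N → F (N / 2 : ℕ) = 1) :
    ∏ s ∈ Finset.range N, F ((s : ℤ) - (N / 2 : ℕ)) =
      ∏ a ∈ Finset.range (N / 2 + 1), F a * F (-a) := by
  set h := N / 2 with hh
  have h1 : ∏ a ∈ Finset.range (h + 1), F (-a) = ∏ s ∈ Finset.range h, F ((s : ℤ) - h) := by
    rw [Finset.prod_range_succ', Nat.cast_zero, neg_zero, h0, mul_one, ← Finset.prod_range_reflect]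
    refine Finset.prod_congr rfl fun s hs => ?_
    have := Finset.mem_range.1 hs
    congr 1
    omega
  have h2 : ∏ a ∈ Finset.range (h + 1), F a = ∏ i ∈ Finset.range (N - h), F i := by
    rcases Nat.even_or_odd N with he | ho
    · have : N - h = h := by obtain ⟨r, hr⟩ := he; omega
      rw [this, Finset.prod_range_succ, hN he, mul_one]
    · have : N - h = h + 1 := by obtain ⟨r, hr⟩ := ho; omega
      rw [this]
  rw [Finset.prod_mul_distrib, h1, h2, mul_comm]
  have h3 : N = h + (N - h) := by omega
  conv_lhs => rw [h3, Finset.prod_range_add]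
  congr 1
  refine Finset.prod_congr rfl fun s _ => ?_
  congr 1
  push_cast
  ring

theorem factorial_mul_eVal_eq_prod_sq {j : ℕ} (hj : 2 < p ^ (j + 1)) (x : ℤ_[p]ˣ) :
    ((p ^ (j + 1)).factorial : ℤ_[p]) * eVal (j + 1) x =
      ∏ a ∈ (Finset.range (p ^ (j + 1) / 2 + 1)).filter (fun a => a.Coprime p),
        ((x : ℤ_[p]) ^ 2 - (a : ℤ_[p]) ^ 2) := by
  have hp : p.Prime := Fact.out
  rw [factorial_mul_eVal, prod_range_centered
    (fun w : ℤ => if (p : ℤ) ∣ w then (1 : ℤ_[p]) else (x : ℤ_[p]) - (w : ℤ_[p])) (by simp) ?_,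
    Finset.prod_filter]
  · refine Finset.prod_congr rfl fun a _ => ?_
    have h1 : (p : ℤ) ∣ (a : ℤ) ↔ ¬ a.Coprime p := by
      rw [Int.natCast_dvd_natCast, Nat.coprime_comm, hp.coprime_iff_not_dvd, not_not]
    by_cases h : a.Coprime p
    · have h2 := not_iff_not.2 h1
      rw [not_not] at h2
      rw [if_neg (h2.2 h), if_neg (fun h3 => h2.2 h ((dvd_neg).1 h3)), if_pos h]
      push_cast
      ring
    · rw [if_pos (h1.2 h), if_pos ((dvd_neg).2 (h1.2 h)), if_neg h, one_mul]
  -- An even length forces `p = 2`; the missing end point is `2 ^ j` with `j ≥ 1`, a multiple of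
  -- `p`, so it contributes `1`.
  · intro he
    have h2 : p = 2 := by
      rw [Nat.even_pow] at he
      exact (Nat.Prime.even_iff hp).1 he.1
    have hj1 : j ≠ 0 := by
      rintro rfl
      simp [h2] at hj
    obtain ⟨i, rfl⟩ := Nat.exists_eq_succ_of_ne_zero hj1
    refine if_pos (Int.natCast_dvd_natCast.2 ?_)
    refine ⟨p ^ i, Nat.div_eq_of_eq_mul_left two_pos ?_⟩
    rw [Nat.succ_eq_add_one, pow_succ, pow_succ]
    nth_rewrite 3 [h2]
    ring

theorem coe_prod {ι : Type*} (s : Finset ι) (f : ι → ℤ_[p]) :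
    ((∏ i ∈ s, f i : ℤ_[p]) : ℚ_[p]) = ∏ i ∈ s, (f i : ℚ_[p]) :=
  map_prod PadicInt.Coe.ringHom f s

theorem coe_sum {ι : Type*} (s : Finset ι) (f : ι → ℤ_[p]) :
    ((∑ i ∈ s, f i : ℤ_[p]) : ℚ_[p]) = ∑ i ∈ s, (f i : ℚ_[p]) :=
  map_sum PadicInt.Coe.ringHom f s

theorem aeval_e (j : ℕ) (x : ℤ_[p]ˣ) :
    aeval ((x : ℤ_[p]) : ℚ_[p]) (e p j) = (eVal j x : ℤ_[p]) := by
  have hp : p.Prime := Fact.out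
  have key : ∀ (i : ℕ) (s : Finset ℕ), ((p ^ (i + 1)).factorial : ℤ_[p]) * eVal (i + 1) x =
      ∏ a ∈ s, ((x : ℤ_[p]) ^ 2 - (a : ℤ_[p]) ^ 2) →
      aeval ((x : ℤ_[p]) : ℚ_[p]) (C (1 / ((p ^ (i + 1)).factorial : ℚ)) *
        ∏ a ∈ s, ((X : ℚ[X]) ^ 2 - C ((a : ℚ) ^ 2))) = (eVal (i + 1) x : ℤ_[p]) := by
    intro i s h
    have h1 := congrArg (fun z : ℤ_[p] => (z : ℚ_[p])) h
    have h0 : ((p ^ (i + 1)).factorial : ℚ_[p]) ≠ 0 := by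
      exact_mod_cast Nat.factorial_ne_zero _
    simp only [PadicInt.coe_mul, PadicInt.coe_natCast, coe_prod, PadicInt.coe_sub,
      PadicInt.coe_pow] at h1
    rw [map_mul, aeval_C, map_prod]
    simp only [map_sub, map_pow, aeval_X, map_natCast, map_div₀, map_one]
    rw [← h1]
    field_simp
  match j with
  | 0 => simp [e, eVal]
  | 1 =>
    by_cases h2 : p = 2
    · subst h2
      have h := factorial_mul_eVal 0 x
      have h3 : (2 : ℤ_[2]) * eVal 1 x = (x : ℤ_[2]) + 1 := by
        simpa [Finset.prod_range_succ] using h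
      have h1 := congrArg (fun z : ℤ_[2] => (z : ℚ_[2])) h3
      simp only [PadicInt.coe_mul, PadicInt.coe_add, PadicInt.coe_one] at h1
      have h4 : ((2 : ℤ_[2]) : ℚ_[2]) = 2 := rfl
      simp only [e, if_true, map_mul, aeval_C, map_add, aeval_X, map_one, map_div₀, map_ofNat]
      rw [← h1, h4]
      ring
    · have h := factorial_mul_eVal_eq_prod_sq (j := 0) (by
        have := hp.two_le
        simp only [zero_add, pow_one]; omega) x
      have h1 := key 0 (Finset.Icc 1 ((p - 1) / 2)) (by
        rw [h]
        refine Finset.prod_congr ?_ fun _ _ => rfl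
        ext a
        obtain ⟨r, hr⟩ := hp.odd_of_ne_two h2
        simp only [Finset.mem_filter, Finset.mem_range, Finset.mem_Icc, zero_add, pow_one]
        constructor
        · rintro ⟨h1, h3⟩
          refine ⟨Nat.pos_of_ne_zero ?_, by omega⟩
          rintro rfl
          exact hp.ne_one (by simpa using h3)
        · rintro ⟨h1, h3⟩
          refine ⟨by omega, ?_⟩
          rw [Nat.coprime_comm]
          exact Nat.coprime_of_lt_prime (by omega) (by omega) hp)
      simpa [e, h2] using h1
  | j + 2 =>
    have h := factorial_mul_eVal_eq_prod_sq (p := p) (j := j + 1) (by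
      have h1 : 2 ^ 2 ≤ p ^ 2 := Nat.pow_le_pow_left hp.two_le 2
      have h2 : p ^ 2 ≤ p ^ (j + 1 + 1) := Nat.pow_le_pow_right hp.pos (by omega)
      omega) x
    exact key (j + 1) _ h

/-- The bound excludes exactly `p = 2`, `j = 0`, where `e_1 = (X + 1) / 2` is not even. -/
theorem eVal_neg {j : ℕ} (hj : 2 < p ^ (j + 1)) (x : ℤ_[p]ˣ) :
    eVal (j + 1) (-x) = eVal (j + 1) x := by
  have h0 : ((p ^ (j + 1)).factorial : ℤ_[p]) ≠ 0 := by exact_mod_cast Nat.factorial_ne_zero _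
  refine mul_left_cancel₀ h0 ?_
  rw [factorial_mul_eVal_eq_prod_sq hj, factorial_mul_eVal_eq_prod_sq hj]
  simp

/-- The value of `e p j` at a `p`-adic unit, modulo `p`. -/
def eMod (j : ℕ) (x : ℤ_[p]ˣ) : ZMod p := PadicInt.toZMod (eVal j x)

/-- Within a class modulo `p ^ (j + 1)` the reduction of `unitPart` is one fixed nonzero constant,
so `e_{j+1}` detects the next digit just as the binomial coefficient does. -/
theorem eMod_eq_iff {j : ℕ} {x y : ℤ_[p]ˣ} (h : (p : ℤ_[p]) ^ (j + 1) ∣ (x : ℤ_[p]) - y) :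
    eMod (j + 1) x = eMod (j + 1) y ↔ (p : ℤ_[p]) ^ (j + 2) ∣ (x : ℤ_[p]) - y := by
  have h1 : PadicInt.toZMod (x : ℤ_[p]) = PadicInt.toZMod (y : ℤ_[p]) :=
    (toZMod_eq_iff _ _).2 ((dvd_pow_self _ (Nat.succ_ne_zero j)).trans h)
  have h2 : ∀ z : ℤ_[p]ˣ, eMod (j + 1) z * PadicInt.toZMod (unitPart (p ^ (j + 1)) (z : ℤ_[p])) =
      PadicInt.toZMod (Ring.choose ((z : ℤ_[p]) + ((p ^ (j + 1) / 2 : ℕ) : ℤ_[p]))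
        (p ^ (j + 1))) := by
    intro z
    rw [eMod, ← map_mul]
    change PadicInt.toZMod (_ * _ * _) = _
    rw [mul_assoc,
      Ring.inverse_mul_cancel _ (isUnit_unitPart (p ^ (j + 1)) z), mul_one]
  have h3 := ((isUnit_unitPart (p ^ (j + 1)) x).map PadicInt.toZMod)
  have h4 : PadicInt.toZMod (unitPart (p ^ (j + 1)) (x : ℤ_[p])) =
      PadicInt.toZMod (unitPart (p ^ (j + 1)) (y : ℤ_[p])) := by
    rw [toZMod_unitPart, toZMod_unitPart, h1]
  rw [← h3.mul_left_inj, h2, h4, h2]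
  rw [toZMod_choose_eq_iff (by rwa [add_sub_add_right_eq_sub]), add_sub_add_right_eq_sub]

theorem eMod_neg {j : ℕ} (hj : 2 < p ^ (j + 1)) (x : ℤ_[p]ˣ) :
    eMod (j + 1) (-x) = eMod (j + 1) x := by
  rw [eMod, eMod, eVal_neg hj]

/-! ### The values of the polynomials `E` -/

/-- The value of `E p (2 * k)` at a `p`-adic unit. -/
def EVal (k : ℕ) (x : ℤ_[p]ˣ) : ℤ_[p] :=
  ∏ j ∈ Finset.range (2 * k + 1), eVal j x ^ phiDigit p (2 * k) j

theorem lead_mul_EVal (k : ℕ) (x : ℤ_[p]ˣ) : (lead p k : ℤ_[p]) * EVal k x =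
    (x : ℤ_[p]) ^ (2 * k) - ∑ i ∈ Finset.range k, (coef k p i : ℤ_[p]) * (x : ℤ_[p]) ^ (2 * i) := by
  have h := congrArg (aeval ((x : ℤ_[p]) : ℚ_[p])) (lead_mul_E (Fact.out : p.Prime) k)
  rw [E, map_mul, map_prod, aeval_C] at h
  simp only [map_pow, aeval_e, map_sub, map_sum, map_mul, aeval_X, map_natCast,
    map_intCast] at h
  apply Subtype.coe_injective
  rw [EVal]
  simp only [PadicInt.coe_mul, PadicInt.coe_sub, PadicInt.coe_pow, coe_prod, coe_sum,
    PadicInt.coe_natCast, PadicInt.coe_intCast]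
  exact h

/-! ### Digits and block decomposition -/

/-- Half of the totient of `p ^ (i + 1)`. -/
def halfTotient (p i : ℕ) : ℕ := p ^ i * (p - 1) / 2

theorem two_mul_halfTotient {p i : ℕ} (hp : p.Prime) (hi : 2 < p ^ (i + 1)) :
    2 * halfTotient p i = p ^ i * (p - 1) := by
  rw [halfTotient, Nat.mul_div_cancel']
  rw [← Nat.totient_prime_pow_succ hp]
  exact (Nat.totient_even hi).two_dvd

theorem two_lt_pow_succ {p i : ℕ} (hp : p.Prime) (hi : 2 < p ^ (i + 1)) : 2 < p ^ (i + 2) :=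
  hi.trans (Nat.pow_lt_pow_right hp.one_lt (by omega))

theorem halfTotient_succ {p i : ℕ} (hp : p.Prime) (hi : 2 < p ^ (i + 1)) :
    halfTotient p (i + 1) = halfTotient p i * p := by
  have h1 := two_mul_halfTotient hp hi
  have h2 := two_mul_halfTotient hp (i := i + 1) (two_lt_pow_succ hp hi)
  rw [pow_succ, mul_right_comm, ← h1] at h2
  linarith

theorem halfTotient_pos {p i : ℕ} (hp : p.Prime) (hi : 2 < p ^ (i + 1)) : 0 < halfTotient p i := by
  have h1 := two_mul_halfTotient hp hi
  have h2 : 0 < p ^ i * (p - 1) := mul_pos (pow_pos hp.pos i) (Nat.sub_pos_of_lt hp.one_lt)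
  omega

/-- The first level with `2 < p ^ (i + 1)`, where `φ(p ^ (i + 1))` is even, is `i = 0` for odd `p`
and `i = 1` for `p = 2`; hence two base cases. -/
theorem level_induction {p : ℕ} (hp : p.Prime) {P : ℕ → Prop} (h0 : 2 < p → P 0)
    (h1 : p = 2 → P 1) (step : ∀ i, 2 < p ^ (i + 1) → P i → P (i + 1)) :
    ∀ i, 2 < p ^ (i + 1) → P i := by
  intro i
  induction i with
  | zero => intro h; exact h0 (by simpa using h)
  | succ i ih =>
    intro h
    by_cases hi : 2 < p ^ (i + 1)
    · exact step i hi (ih hi)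
    · have h2 : p ^ 1 ≤ p ^ (i + 1) := Nat.pow_le_pow_right hp.pos (by omega)
      have h3 := hp.two_le
      rw [pow_one] at h2
      have h4 : p = 2 := by omega
      subst h4
      have h5 : i = 0 := by
        by_contra h6
        have h7 : 2 ^ 2 ≤ 2 ^ (i + 1) := Nat.pow_le_pow_right two_pos (by omega)
        omega
      subst h5
      exact h1 rfl

theorem phiDigit_eq_zero {p n j : ℕ} (hp : p.Prime) (h : n < j) : phiDigit p n j = 0 := by
  obtain ⟨i, rfl⟩ := Nat.exists_eq_succ_of_ne_zero (Nat.ne_zero_of_lt h)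
  have h1 : n / (p - 1) < p ^ i :=
    ((Nat.div_le_self _ _).trans (Nat.lt_succ_iff.1 h)).trans_lt (Nat.lt_pow_self hp.one_lt)
  rw [phiDigit, Nat.div_eq_of_lt h1, Nat.zero_mod]

/-- The summand is `a φ(p ^ (i + 1))`, and the bound on `n` says that its digits from index `i + 1`
on vanish, so there is no carry. -/
theorem phiDigit_add {p n i a : ℕ} (hp : p.Prime) (hn : n < p ^ i * (p - 1)) (ha : a < p) (j : ℕ) :
    phiDigit p (n + p ^ i * (p - 1) * a) j = phiDigit p n j + if j = i + 1 then a else 0 := by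
  have hp1 : 0 < p - 1 := Nat.sub_pos_of_lt hp.one_lt
  have hq : n / (p - 1) < p ^ i := Nat.div_lt_of_lt_mul (by rwa [mul_comm])
  have h1 : (n + p ^ i * (p - 1) * a) / (p - 1) = n / (p - 1) + p ^ i * a := by
    rw [mul_right_comm, Nat.add_mul_div_right _ _ hp1]
  cases j with
  | zero =>
    rw [phiDigit, phiDigit, mul_right_comm, Nat.add_mul_mod_self_right, if_neg (by omega), add_zero]
  | succ t =>
    rw [phiDigit, phiDigit, h1]
    rcases lt_trichotomy t i with h | rfl | h
    · obtain ⟨d, rfl⟩ := Nat.exists_eq_add_of_lt h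
      have h2 : p ^ (t + d + 1) * a = p ^ t * (p * (p ^ d * a)) := by ring
      rw [h2, Nat.add_mul_div_left _ _ (pow_pos hp.pos t), Nat.add_mul_mod_self_left,
        if_neg (by omega), add_zero]
    · rw [Nat.add_mul_div_left _ _ (pow_pos hp.pos t), Nat.div_eq_of_lt hq, if_pos rfl, zero_add,
        Nat.zero_mod, zero_add, Nat.mod_eq_of_lt ha]
    · have h2 : p ^ i * p ≤ p ^ t := by
        rw [← pow_succ]; exact Nat.pow_le_pow_right hp.pos h
      have h3 : n / (p - 1) + p ^ i * a < p ^ t := by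
        have : p ^ i * (a + 1) ≤ p ^ i * p := Nat.mul_le_mul_left _ ha
        rw [mul_add] at this
        omega
      rw [Nat.div_eq_of_lt h3, Nat.div_eq_of_lt (hq.trans (Nat.pow_lt_pow_right hp.one_lt h)),
        if_neg (by omega), add_zero]

theorem sum_range_mul_eq {M : Type*} [AddCommMonoid M] (f : ℕ → M) (T n : ℕ) :
    ∑ k ∈ Finset.range (T * n), f k =
      ∑ a ∈ Finset.range n, ∑ k ∈ Finset.range T, f (k + T * a) := by
  induction n with
  | zero => simp
  | succ n ih =>
    rw [mul_add, mul_one, Finset.sum_range_add, ih, Finset.sum_range_succ]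
    simp only [add_comm]

theorem eq_zero_of_sum_mul_pow_eq_zero {F : Type*} [Field F] (g : ℕ → F) (d : ℕ) (S : Finset F)
    (hd : d ≤ S.card) (h : ∀ c ∈ S, ∑ a ∈ Finset.range d, g a * c ^ a = 0) :
    ∀ a < d, g a = 0 := by
  intro a ha
  set P : F[X] := ∑ a ∈ Finset.range d, C (g a) * X ^ a with hP
  have hc : P.coeff a = g a := by
    rw [hP, finsetSum_coeff, Finset.sum_eq_single a]
    · simp
    · intro b _ hb
      rw [coeff_C_mul, coeff_X_pow, if_neg hb.symm, mul_zero]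
    · intro h; exact absurd (Finset.mem_range.2 ha) h
  have h0 : P = 0 := by
    refine Polynomial.eq_zero_of_degree_lt_of_eval_finset_eq_zero S ?_ ?_
    · refine lt_of_lt_of_le ?_ (Nat.cast_le.2 hd)
      rw [hP, ← mem_degreeLT]
      refine Submodule.sum_mem _ fun b hb => mem_degreeLT.2 ?_
      exact (degree_C_mul_X_pow_le _ _).trans_lt (Nat.cast_lt.2 (Finset.mem_range.1 hb))
    · intro c hc
      rw [hP, eval_finsetSum, ← h c hc]
      simp
  rw [← hc, h0, coeff_zero]

/-- Written in `c` instead of `c ^ 2`, the sum can be tested on all nonzero residues by counting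
roots. -/
theorem sum_range_even {F : Type*} [Field F] (r : ℕ → F) (c : F) (T : ℕ) :
    ∑ k ∈ Finset.range T, r k * c ^ (2 * k) =
      ∑ a ∈ Finset.range (2 * T), (if Even a then r (a / 2) else 0) * c ^ a := by
  induction T with
  | zero => simp
  | succ T ih =>
    have h : ¬ Even (2 * T + 1) := by simp [parity_simps]
    rw [Finset.sum_range_succ, ih, mul_add, mul_one, Finset.sum_range_succ, Finset.sum_range_succ,
      if_neg h, if_pos (even_two_mul T)]
    simp

/-! ### The functions `E` modulo `p` -/

/-- The value of `E p (2 * k)` at a `p`-adic unit, modulo `p`. -/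
def EMod (k : ℕ) (x : ℤ_[p]ˣ) : ZMod p := PadicInt.toZMod (EVal k x)

theorem EMod_eq_prod {k N : ℕ} (hN : 2 * k + 1 ≤ N) (x : ℤ_[p]ˣ) :
    EMod k x = ∏ j ∈ Finset.range N, eMod j x ^ phiDigit p (2 * k) j := by
  rw [EMod, EVal, map_prod]
  simp only [map_pow]
  refine Finset.prod_subset (Finset.range_subset_range.2 hN) fun j _ hj => ?_
  rw [Finset.mem_range] at hj
  rw [phiDigit_eq_zero hpf.out (by omega), pow_zero]

theorem EMod_add {k i a : ℕ} (hi : 2 < p ^ (i + 1)) (hk : k < halfTotient p i) (ha : a < p)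
    (x : ℤ_[p]ˣ) : EMod (k + halfTotient p i * a) x = EMod k x * eMod (i + 1) x ^ a := by
  have hT := two_mul_halfTotient hpf.out hi
  set N := 2 * (k + halfTotient p i * a) + i + 2 with hN
  have h0 : 2 * (k + halfTotient p i * a) = 2 * k + p ^ i * (p - 1) * a := by
    rw [← hT]; ring
  rw [EMod_eq_prod (N := N) (by omega), EMod_eq_prod (k := k) (N := N) (by
    have := Nat.zero_le (halfTotient p i * a); omega)]
  have h1 : eMod (i + 1) x ^ a =
      ∏ j ∈ Finset.range N, eMod j x ^ (if j = i + 1 then a else 0) := by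
    rw [Finset.prod_eq_single (i + 1)]
    · simp
    · intro j _ hj
      rw [if_neg hj, pow_zero]
    · intro h
      exact absurd (Finset.mem_range.2 (by omega)) h
  rw [h1, ← Finset.prod_mul_distrib]
  refine Finset.prod_congr rfl fun j _ => ?_
  rw [h0, phiDigit_add hpf.out (by omega) ha, pow_add]

theorem EMod_of_lt {k : ℕ} (hk : 2 * k < p - 1) (x : ℤ_[p]ˣ) :
    EMod k x = PadicInt.toZMod (x : ℤ_[p]) ^ (2 * k) := by
  rw [EMod_eq_prod le_rfl, Finset.prod_eq_single 0]
  · rw [phiDigit, Nat.mod_eq_of_lt hk]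
    rfl
  · intro j _ hj
    obtain ⟨i, rfl⟩ := Nat.exists_eq_succ_of_ne_zero hj
    rw [phiDigit, Nat.div_eq_of_lt hk, Nat.zero_div, Nat.zero_mod, pow_zero]
  · intro h
    exact absurd (Finset.mem_range.2 (Nat.succ_pos _)) h

theorem EMod_zero (x : ℤ_[p]ˣ) : EMod 0 x = 1 := by
  rw [EMod_of_lt (by simpa using hpf.out.one_lt), mul_zero, pow_zero]

theorem exists_unit_toZMod {c : ZMod p} (hc : c ≠ 0) :
    ∃ x : ℤ_[p]ˣ, PadicInt.toZMod (x : ℤ_[p]) = c := by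
  obtain ⟨z, rfl⟩ := ZMod.ringHom_surjective (PadicInt.toZMod (p := p)) c
  obtain ⟨u, rfl⟩ := (isUnit_iff_toZMod_ne_zero z).2 hc
  exact ⟨u, rfl⟩

/-- The `p` lifts `x + p ^ (i + 1) t` have distinct values by `eMod_eq_iff`, so they exhaust `ZMod
p`. -/
theorem exists_eMod_eq {i : ℕ} (x : ℤ_[p]ˣ) (c : ZMod p) :
    ∃ y : ℤ_[p]ˣ, (p : ℤ_[p]) ^ (i + 1) ∣ (y : ℤ_[p]) - x ∧ eMod (i + 1) y = c := by
  have hu : ∀ t : ZMod p, IsUnit ((x : ℤ_[p]) + p ^ (i + 1) * (t.val : ℤ_[p])) := by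
    intro t
    rw [isUnit_iff_toZMod_ne_zero]
    simpa using toZMod_unit_ne_zero x
  have hy : ∀ t, (p : ℤ_[p]) ^ (i + 1) ∣ ((hu t).unit : ℤ_[p]) - x := by
    intro t
    rw [IsUnit.unit_spec, add_sub_cancel_left]
    exact dvd_mul_right _ _
  have hinj : Function.Injective fun t => eMod (i + 1) (hu t).unit := by
    intro t s hts
    have h1 : (p : ℤ_[p]) ^ (i + 1) ∣ ((hu t).unit : ℤ_[p]) - ((hu s).unit : ℤ_[p]) := by
      have := dvd_sub (hy t) (hy s)
      rwa [sub_sub_sub_cancel_right] at this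
    have h2 := (eMod_eq_iff h1).1 hts
    rw [IsUnit.unit_spec, IsUnit.unit_spec, add_sub_add_left_eq_sub, ← mul_sub,
      pow_succ _ (i + 1)] at h2
    have h3 := (mul_dvd_mul_iff_left (pow_ne_zero (i + 1)
      (Nat.cast_ne_zero.2 hpf.out.ne_zero : (p : ℤ_[p]) ≠ 0))).1 h2
    have h4 := (toZMod_eq_iff _ _).2 h3
    simpa using h4
  obtain ⟨t, ht⟩ := Finite.surjective_of_injective hinj c
  exact ⟨_, hy t, ht⟩

/-- By `EMod_add`, passing to the next level only multiplies by powers of `e_{i+1}`, which sees one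
more digit. -/
theorem EMod_congr (i : ℕ) (hi : 2 < p ^ (i + 1)) : ∀ k < halfTotient p i, ∀ x y : ℤ_[p]ˣ,
    (p : ℤ_[p]) ^ (i + 1) ∣ (x : ℤ_[p]) - y → EMod k x = EMod k y := by
  revert hi i
  refine level_induction hpf.out ?_ ?_ ?_
  · intro h2 k hk x y hxy
    have h3 := two_mul_halfTotient hpf.out (i := 0) (by simpa using h2)
    rw [pow_zero, one_mul] at h3
    rw [EMod_of_lt (by omega), EMod_of_lt (by omega), (toZMod_eq_iff _ _).2 (by simpa using hxy)]
  · rintro rfl k hk x y -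
    have h0 : k = 0 := by simpa [halfTotient] using hk
    rw [h0, EMod_zero, EMod_zero]
  · intro i hi ih k hk x y hxy
    rw [halfTotient_succ hpf.out hi] at hk
    have hT := halfTotient_pos hpf.out hi
    have h1 := (dvd_trans (pow_dvd_pow (p : ℤ_[p]) (Nat.le_succ (i + 1))) hxy)
    rw [← Nat.mod_add_div k (halfTotient p i), EMod_add hi (Nat.mod_lt _ hT)
      (Nat.div_lt_of_lt_mul hk), EMod_add hi (Nat.mod_lt _ hT) (Nat.div_lt_of_lt_mul hk),
      ih _ (Nat.mod_lt _ hT) x y h1, (eMod_eq_iff h1).2 hxy]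

theorem sum_EMod_block {i : ℕ} (hi : 2 < p ^ (i + 1)) (r : ℕ → ZMod p) (x : ℤ_[p]ˣ) :
    ∑ k ∈ Finset.range (halfTotient p (i + 1)), r k * EMod k x =
      ∑ a ∈ Finset.range p, (∑ k ∈ Finset.range (halfTotient p i),
        r (k + halfTotient p i * a) * EMod k x) * eMod (i + 1) x ^ a := by
  rw [halfTotient_succ hpf.out hi, sum_range_mul_eq]
  refine Finset.sum_congr rfl fun a ha => ?_
  rw [Finset.sum_mul]
  refine Finset.sum_congr rfl fun k hk => ?_
  rw [EMod_add hi (Finset.mem_range.1 hk) (Finset.mem_range.1 ha), mul_assoc]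

/-- The functions `EMod` are linearly independent. -/
theorem eq_zero_of_sum_EMod_eq_zero (i : ℕ) (hi : 2 < p ^ (i + 1)) : ∀ r : ℕ → ZMod p,
    (∀ x : ℤ_[p]ˣ, ∑ k ∈ Finset.range (halfTotient p i), r k * EMod k x = 0) →
      ∀ k < halfTotient p i, r k = 0 := by
  revert hi i
  refine level_induction hpf.out ?_ ?_ ?_
  · intro h2 r h k hk
    have h3 := two_mul_halfTotient hpf.out (i := 0) (by simpa using h2)
    rw [pow_zero, one_mul] at h3
    have h4 := eq_zero_of_sum_mul_pow_eq_zero (fun a => if Even a then r (a / 2) else 0)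
      (2 * halfTotient p 0) (Finset.univ.erase (0 : ZMod p)) (by
        rw [Finset.card_erase_of_mem (Finset.mem_univ _), Finset.card_univ, ZMod.card]
        omega) (by
        intro c hc
        obtain ⟨x, rfl⟩ := exists_unit_toZMod (Finset.ne_of_mem_erase hc)
        rw [← sum_range_even, ← h x]
        refine Finset.sum_congr rfl fun k hk => ?_
        rw [EMod_of_lt]
        have := Finset.mem_range.1 hk
        omega) (2 * k) (by omega)
    simpa using h4
  · rintro rfl r h k hk
    have h1 : halfTotient 2 1 = 1 := by simp [halfTotient]
    have h0 : k = 0 := by omega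
    have h2 := h 1
    rw [h1, Finset.sum_range_one, EMod_zero, mul_one] at h2
    rw [h0, h2]
  · intro i hi ih r h k hk
    rw [halfTotient_succ hpf.out hi] at hk
    have hT := halfTotient_pos hpf.out hi
    have h1 : ∀ a < p, ∀ x : ℤ_[p]ˣ, ∑ k ∈ Finset.range (halfTotient p i),
        r (k + halfTotient p i * a) * EMod k x = 0 := by
      intro a ha x
      refine eq_zero_of_sum_mul_pow_eq_zero (fun a => ∑ k ∈ Finset.range (halfTotient p i),
        r (k + halfTotient p i * a) * EMod k x) p Finset.univ
        (by rw [Finset.card_univ, ZMod.card]) ?_ a ha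
      intro c _
      -- Moving `y` within the class of `x` lets `e_{i+1}` take every value while the inner sums
      -- stay fixed: a polynomial of degree below `p` vanishes on all of `ZMod p`.
      obtain ⟨y, hy, rfl⟩ := exists_eMod_eq (i := i) x c
      rw [← h y, sum_EMod_block hi]
      refine Finset.sum_congr rfl fun a _ => ?_
      congr 1
      refine Finset.sum_congr rfl fun k hk => ?_
      rw [EMod_congr i hi k (Finset.mem_range.1 hk) y x hy]
    have h2 := ih (fun l => r (l + halfTotient p i * (k / halfTotient p i)))
      (h1 _ (Nat.div_lt_of_lt_mul hk)) (k % halfTotient p i) (Nat.mod_lt _ hT)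
    rwa [Nat.mod_add_div] at h2

open Classical in
/-- The indicator functions of the classes modulo `p ^ (i + 1)`, up to sign, are combinations of
the functions `EMod`. -/
theorem exists_sum_EMod_eq_indicator (i : ℕ) (hi : 2 < p ^ (i + 1)) : ∀ y : ℤ_[p]ˣ,
    ∃ r : ℕ → ZMod p, ∀ x : ℤ_[p]ˣ,
      ∑ k ∈ Finset.range (halfTotient p i), r k * EMod k x =
        if (p : ℤ_[p]) ^ (i + 1) ∣ (x : ℤ_[p]) - y ∨ (p : ℤ_[p]) ^ (i + 1) ∣ (x : ℤ_[p]) + y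
          then 1 else 0 := by
  revert hi i
  refine level_induction hpf.out ?_ ?_ ?_
  · intro h2 y
    have h3 := two_mul_halfTotient hpf.out (i := 0) (by simpa using h2)
    rw [pow_zero, one_mul] at h3
    set b := PadicInt.toZMod (y : ℤ_[p]) with hb
    have hb0 : b ≠ 0 := toZMod_unit_ne_zero y
    -- A geometric sum in `(a / b) ^ 2` of length `(p - 1) / 2`: it vanishes by Fermat unless the
    -- ratio is `1`, when it equals `-1 / 2`; hence the factor `-2`.
    refine ⟨fun k => -2 * (b⁻¹) ^ (2 * k), fun x => ?_⟩
    set a := PadicInt.toZMod (x : ℤ_[p]) with ha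
    have ha0 : a ≠ 0 := toZMod_unit_ne_zero x
    have h4 : ∑ k ∈ Finset.range (halfTotient p 0), -2 * (b⁻¹) ^ (2 * k) * EMod k x =
        -2 * ∑ k ∈ Finset.range (halfTotient p 0), ((a * b⁻¹) ^ 2) ^ k := by
      rw [Finset.mul_sum]
      refine Finset.sum_congr rfl fun k hk => ?_
      have := Finset.mem_range.1 hk
      rw [EMod_of_lt (by omega), ← pow_mul, mul_pow]
      ring
    have h5 : ((p : ℤ_[p]) ^ (0 + 1) ∣ (x : ℤ_[p]) - y ∨ (p : ℤ_[p]) ^ (0 + 1) ∣ (x : ℤ_[p]) + y) ↔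
        (a * b⁻¹) ^ 2 = 1 := by
      rw [zero_add, pow_one, ← sub_neg_eq_add, ← toZMod_eq_iff, ← toZMod_eq_iff, map_neg,
        ← one_pow 2, sq_eq_sq_iff_eq_or_eq_neg, ← div_eq_mul_inv, div_eq_iff hb0, div_eq_iff hb0,
        one_mul, neg_one_mul]
    rw [h4]
    split_ifs with h
    · rw [h5.1 h]
      have h6 : ((2 * halfTotient p 0 : ℕ) : ZMod p) = -1 := by
        rw [h3, Nat.cast_sub hpf.out.one_le]
        simp
      push_cast at h6
      simp only [one_pow, Finset.sum_const, Finset.card_range, nsmul_eq_mul, mul_one]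
      linear_combination -h6
    · rw [h5] at h
      have h6 := geom_sum_mul ((a * b⁻¹) ^ 2) (halfTotient p 0)
      rw [← pow_mul, h3, ZMod.pow_card_sub_one_eq_one (mul_ne_zero ha0 (inv_ne_zero hb0)),
        sub_self] at h6
      rw [(mul_eq_zero.1 h6).resolve_right (sub_ne_zero.2 h), mul_zero]
  · rintro rfl y
    refine ⟨fun _ => 1, fun x => ?_⟩
    have h1 : halfTotient 2 1 = 1 := by simp [halfTotient]
    rw [h1, Finset.sum_range_one, EMod_zero, mul_one, if_pos]
    -- The units modulo `4` are `1` and `-1`, so there is a single class up to sign and its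
    -- indicator is `E_0 = 1`.
    have h4 : ∀ a a' b b' : ZMod (2 ^ 2), a * a' = 1 → b * b' = 1 → a - b = 0 ∨ a + b = 0 := by
      decide
    have h5 : ∀ z : ℤ_[2]ˣ, PadicInt.toZModPow 2 (z : ℤ_[2]) *
        PadicInt.toZModPow 2 ((z⁻¹ : ℤ_[2]ˣ) : ℤ_[2]) = 1 := by
      intro z
      rw [← map_mul, Units.mul_inv, map_one]
    have h6 := h4 _ _ _ _ (h5 x) (h5 y)
    rwa [← map_sub, ← map_add, toZModPow_eq_zero_iff, toZModPow_eq_zero_iff] at h6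
  · intro i hi ih y
    obtain ⟨r, hr⟩ := ih y
    have hT := halfTotient_pos hpf.out hi
    set c := eMod (i + 1) y with hc
    -- By Fermat `Q` is the indicator of `c`, and its degree `p - 1` fits the available powers of
    -- `e_{i+1}`. Multiplying by it refines the indicator from level `i` to level `i + 1`, for both
    -- signs at once as `e_{i+1}` is even.
    set Q : (ZMod p)[X] := 1 - (X - C c) ^ (p - 1) with hQ
    have hQd : Q.natDegree < p := by
      refine lt_of_le_of_lt (natDegree_sub_le _ _) ?_
      rw [natDegree_one, natDegree_pow, natDegree_X_sub_C, mul_one]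
      have := hpf.out.pos
      omega
    refine ⟨fun k => r (k % halfTotient p i) * Q.coeff (k / halfTotient p i), fun x => ?_⟩
    rw [sum_EMod_block hi]
    have h1 : ∀ a ∈ Finset.range p, (∑ k ∈ Finset.range (halfTotient p i),
        r ((k + halfTotient p i * a) % halfTotient p i) *
          Q.coeff ((k + halfTotient p i * a) / halfTotient p i) * EMod k x) * eMod (i + 1) x ^ a =
        (∑ k ∈ Finset.range (halfTotient p i), r k * EMod k x) *
          (Q.coeff a * eMod (i + 1) x ^ a) := by
      intro a _
      rw [← mul_assoc, Finset.sum_mul (a := Q.coeff a)]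
      congr 1
      refine Finset.sum_congr rfl fun k hk => ?_
      have hk := Finset.mem_range.1 hk
      rw [Nat.add_mul_mod_self_left, Nat.mod_eq_of_lt hk, Nat.add_mul_div_left _ _ hT,
        Nat.div_eq_of_lt hk, zero_add]
      ring
    rw [Finset.sum_congr rfl h1, ← Finset.mul_sum, ← eval_eq_sum_range' hQd, hr x]
    have h2 : Q.eval (eMod (i + 1) x) = if eMod (i + 1) x = c then 1 else 0 := by
      rw [hQ]
      simp only [eval_sub, eval_one, eval_pow, eval_X, eval_C]
      split_ifs with h
      · rw [h, sub_self, zero_pow (Nat.sub_pos_of_lt hpf.out.one_lt).ne', sub_zero]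
      · rw [ZMod.pow_card_sub_one_eq_one (sub_ne_zero.2 h), sub_self]
    rw [h2, ite_zero_mul_ite_zero, mul_one]
    have hle : ∀ z : ℤ_[p], (p : ℤ_[p]) ^ (i + 1 + 1) ∣ z → (p : ℤ_[p]) ^ (i + 1) ∣ z :=
      fun z hz => (pow_dvd_pow _ (Nat.le_succ _)).trans hz
    have hA : (p : ℤ_[p]) ^ (i + 1) ∣ (x : ℤ_[p]) - y →
        (eMod (i + 1) x = c ↔ (p : ℤ_[p]) ^ (i + 1 + 1) ∣ (x : ℤ_[p]) - y) := eMod_eq_iff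
    have hB : (p : ℤ_[p]) ^ (i + 1) ∣ (x : ℤ_[p]) + y →
        (eMod (i + 1) x = c ↔ (p : ℤ_[p]) ^ (i + 1 + 1) ∣ (x : ℤ_[p]) + y) := by
      have h3 := eMod_eq_iff (j := i) (x := x) (y := -y)
      rwa [eMod_neg hi, Units.val_neg, sub_neg_eq_add] at h3
    congr 1
    rw [eq_iff_iff]
    constructor
    · rintro ⟨h3 | h3, h4⟩
      · exact Or.inl ((hA h3).1 h4)
      · exact Or.inr ((hB h3).1 h4)
    · rintro (h3 | h3)
      · exact ⟨Or.inl (hle _ h3), (hA (hle _ h3)).2 h3⟩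
      · exact ⟨Or.inr (hle _ h3), (hB (hle _ h3)).2 h3⟩

/-- Every even function on the units modulo `p ^ (i + 1)` is a combination of the functions
`EMod`. -/
theorem exists_sum_EMod_eq {i : ℕ} (hi : 2 < p ^ (i + 1)) (f : ℤ_[p]ˣ → ZMod p)
    (hneg : ∀ x, f (-x) = f x)
    (hf : ∀ x y : ℤ_[p]ˣ, (p : ℤ_[p]) ^ (i + 1) ∣ (x : ℤ_[p]) - y → f x = f y) :
    ∃ r : ℕ → ZMod p, ∀ x, f x = ∑ k ∈ Finset.range (halfTotient p i), r k * EMod k x := by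
  classical
  -- The unordered pair of `x` and `-x` labels the class up to sign in a finite type, over which the
  -- indicators can be summed.
  let g : ℤ_[p]ˣ → Sym2 (ZMod (p ^ (i + 1))) := fun x =>
    s(PadicInt.toZModPow (i + 1) (x : ℤ_[p]), -PadicInt.toZModPow (i + 1) (x : ℤ_[p]))
  have hg : ∀ x y, g x = g y ↔
      (p : ℤ_[p]) ^ (i + 1) ∣ (x : ℤ_[p]) - y ∨ (p : ℤ_[p]) ^ (i + 1) ∣ (x : ℤ_[p]) + y := by
    intro x y
    rw [← toZModPow_eq_zero_iff, ← toZModPow_eq_zero_iff, map_sub, map_add, sub_eq_zero,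
      add_eq_zero_iff_eq_neg]
    simp only [g, Sym2.eq_iff, and_self, neg_eq_iff_eq_neg, neg_neg]
  have key : ∀ c, ∃ r : ℕ → ZMod p, ∀ x : ℤ_[p]ˣ,
      ∑ k ∈ Finset.range (halfTotient p i), r k * EMod k x = if g x = c then f x else 0 := by
    intro c
    by_cases hc : ∃ y, g y = c
    · obtain ⟨y, rfl⟩ := hc
      obtain ⟨r, hr⟩ := exists_sum_EMod_eq_indicator i hi y
      refine ⟨fun k => f y * r k, fun x => ?_⟩
      simp only [mul_assoc, ← Finset.mul_sum, hr, hg]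
      split_ifs with h
      · rw [mul_one]
        rcases h with h | h
        · exact (hf x y h).symm
        · rw [← hneg y]
          exact (hf x (-y) (by simpa using h)).symm
      · rw [mul_zero]
    · refine ⟨0, fun x => ?_⟩
      rw [if_neg fun h => hc ⟨x, h⟩]
      simp
  choose r hr using key
  have : NeZero (p ^ (i + 1)) := ⟨pow_ne_zero _ hpf.out.ne_zero⟩
  refine ⟨fun k => ∑ c, r c k, fun x => ?_⟩
  simp only [Finset.sum_mul]
  rw [Finset.sum_comm]
  simp only [hr]
  simp

/-! ### Extension of functionals from a dense lattice -/

section Extension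

variable {W V : Type*} [AddCommGroup W] [Module ℤ_[p] W] [AddCommGroup V]
  [Module ℤ_[p] V]

theorem exists_padic_limit (z : ℕ → ℤ_[p]) (h : ∀ n, (p : ℤ_[p]) ^ n ∣ z (n + 1) - z n) :
    ∃ L : ℤ_[p], ∀ n, (p : ℤ_[p]) ^ n ∣ L - z n := by
  have hmem : ∀ n : ℕ, ∀ a b : ℤ_[p], (p : ℤ_[p]) ^ n ∣ b - a ↔
      a ≡ b [SMOD (IsLocalRing.maximalIdeal ℤ_[p] ^ n • ⊤ : Submodule ℤ_[p] ℤ_[p])] := by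
    intro n a b
    rw [SModEq.comm, SModEq.sub_mem, PadicInt.maximalIdeal_eq_span_p, Ideal.span_singleton_pow,
      smul_eq_mul, Ideal.mul_top, Ideal.mem_span_singleton]
  have h' : ∀ {m n : ℕ}, m ≤ n → (p : ℤ_[p]) ^ m ∣ z n - z m := by
    intro m n hmn
    induction n, hmn using Nat.le_induction with
    | base => simp
    | succ n hmn ih =>
      rw [← sub_add_sub_cancel _ (z n)]
      exact dvd_add ((pow_dvd_pow _ hmn).trans (h n)) ih
  obtain ⟨L, hL⟩ := IsPrecomplete.prec'
    (I := IsLocalRing.maximalIdeal ℤ_[p]) (M := ℤ_[p]) z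
    (fun {m n} hmn => (hmem m _ _).1 (h' hmn))
  exact ⟨L, fun n => (hmem n _ _).2 (hL n)⟩

theorem eq_of_forall_pow_dvd_sub {a b : ℤ_[p]} (h : ∀ n, (p : ℤ_[p]) ^ n ∣ a - b) : a = b := by
  rw [← PadicInt.ext_of_toZModPow]
  intro n
  rw [← sub_eq_zero, ← map_sub, toZModPow_eq_zero_iff]
  exact h n

/-- A functional on a `p`-adically dense and saturated submodule extends to the whole module. -/
theorem exists_extension (Φ : W →ₗ[ℤ_[p]] V) (Γ : W →ₗ[ℤ_[p]] ℤ_[p])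
    (htf : ∀ v : V, (p : ℤ_[p]) • v = 0 → v = 0)
    (hsat : ∀ (r : W) (g : V), Φ r = (p : ℤ_[p]) • g → ∃ r', r = (p : ℤ_[p]) • r')
    (hdense : ∀ f : V, ∃ (r : W) (g : V), f = Φ r + (p : ℤ_[p]) • g) :
    ∃ μ : V →ₗ[ℤ_[p]] ℤ_[p], ∀ r, μ (Φ r) = Γ r := by
  have hsat' : ∀ (n : ℕ) (r : W) (g : V), Φ r = (p : ℤ_[p]) ^ n • g →
      ∃ r', r = (p : ℤ_[p]) ^ n • r' := by
    intro n
    induction n with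
    | zero => intro r g _; exact ⟨r, by simp⟩
    | succ n ih =>
      intro r g h
      obtain ⟨r₁, rfl⟩ := hsat r ((p : ℤ_[p]) ^ n • g) (by rw [h, smul_smul, pow_succ'])
      obtain ⟨r₂, rfl⟩ := ih r₁ g (by
        rw [← sub_eq_zero]
        refine htf _ ?_
        rw [smul_sub, ← map_smul, h, smul_smul, pow_succ', sub_self])
      exact ⟨r₂, by rw [smul_smul, pow_succ']⟩
  have hdense' : ∀ (f : V) (n : ℕ), ∃ (r : W) (g : V), f = Φ r + (p : ℤ_[p]) ^ n • g := by
    intro f n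
    induction n with
    | zero => exact ⟨0, f, by simp⟩
    | succ n ih =>
      obtain ⟨r, g, hf⟩ := ih
      obtain ⟨r', g', hg⟩ := hdense g
      refine ⟨r + (p : ℤ_[p]) ^ n • r', g', ?_⟩
      rw [hf]
      nth_rewrite 1 [hg]
      rw [map_add, map_smul, smul_add, smul_smul, pow_succ, add_assoc]
  -- `Q f z` says that `z` is the limit of `Γ r` along approximations `Φ r` of `f`. Existence and
  -- uniqueness of `z` define the extension, and uniqueness also yields linearity.
  let Q : V → ℤ_[p] → Prop := fun f z => ∀ n : ℕ, ∃ (r : W) (g : V),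
    f = Φ r + (p : ℤ_[p]) ^ n • g ∧ (p : ℤ_[p]) ^ n ∣ z - Γ r
  -- Saturation enters here: modulo `p ^ n`, the value `Γ r` depends only on `f`.
  have hcompare : ∀ (f : V) (n : ℕ) (r r' : W) (g g' : V), f = Φ r + (p : ℤ_[p]) ^ n • g →
      f = Φ r' + (p : ℤ_[p]) ^ n • g' → (p : ℤ_[p]) ^ n ∣ Γ r - Γ r' := by
    intro f n r r' g g' h h'
    obtain ⟨s, hs⟩ := hsat' n (r - r') (g' - g) (by
      rw [map_sub, smul_sub, sub_eq_sub_iff_add_eq_add, ← h, h', add_comm])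
    rw [← map_sub, hs, map_smul, smul_eq_mul]
    exact dvd_mul_right _ _
  have huniq : ∀ f z z', Q f z → Q f z' → z = z' := by
    intro f z z' h h'
    refine eq_of_forall_pow_dvd_sub fun n => ?_
    obtain ⟨r, g, h1, h2⟩ := h n
    obtain ⟨r', g', h1', h2'⟩ := h' n
    have h3 := dvd_sub (dvd_add h2 (hcompare f n r r' g g' h1 h1')) h2'
    have h4 : z - Γ r + (Γ r - Γ r') - (z' - Γ r') = z - z' := by ring
    rwa [h4] at h3
  have hex : ∀ f, ∃ z, Q f z := by
    intro f
    choose r g hrg using hdense' f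
    obtain ⟨L, hL⟩ := exists_padic_limit (fun n => Γ (r n)) fun n =>
      hcompare f n _ _ ((p : ℤ_[p]) • g (n + 1)) (g n)
        (by rw [smul_smul, ← pow_succ]; exact hrg (n + 1)) (hrg n)
    exact ⟨L, fun n => ⟨r n, g n, hrg n, hL n⟩⟩
  choose μ hμ using hex
  refine ⟨{ toFun := μ, map_add' := ?_, map_smul' := ?_ }, ?_⟩
  · intro f f'
    refine huniq _ _ _ (hμ _) fun n => ?_
    obtain ⟨r, g, h1, h2⟩ := hμ f n
    obtain ⟨r', g', h1', h2'⟩ := hμ f' n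
    refine ⟨r + r', g + g', ?_, ?_⟩
    · nth_rewrite 1 [h1, h1']
      rw [map_add, smul_add]
      abel
    · rw [map_add, add_sub_add_comm]
      exact dvd_add h2 h2'
  · intro c f
    refine huniq _ _ _ (hμ _) fun n => ?_
    obtain ⟨r, g, h1, h2⟩ := hμ f n
    refine ⟨c • r, c • g, ?_, ?_⟩
    · nth_rewrite 1 [h1]
      rw [map_smul, smul_add, smul_comm]
    · rw [map_smul, RingHom.id_apply, ← smul_sub]
      exact h2.mul_left c
  · intro r
    exact huniq _ _ _ (hμ _) fun n => ⟨r, 0, by simp, by simp⟩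

end Extension

/-! ### Continuous functions on the units modulo sign -/

/-- Multiplication by `c` is a closed embedding since `ℤ_p` is compact, so the pointwise quotient is
continuous. -/
theorem exists_smul_eq_of_forall_dvd {Y : Type*} [TopologicalSpace Y] {c : ℤ_[p]} (hc : c ≠ 0)
    (f : C(Y, ℤ_[p])) (h : ∀ y, c ∣ f y) : ∃ g : C(Y, ℤ_[p]), f = c • g := by
  choose g hg using h
  have he : Topology.IsClosedEmbedding fun z : ℤ_[p] => c * z :=
    (continuous_const.mul continuous_id).isClosedEmbedding (mul_right_injective₀ hc)
  refine ⟨⟨g, he.isInducing.continuous_iff.2 ?_⟩, ContinuousMap.ext hg⟩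
  have h1 : (fun z : ℤ_[p] => c * z) ∘ g = f := funext fun y => (hg y).symm
  rw [h1]
  exact f.continuous

theorem evenPow_mk (k : ℕ) (x : ℤ_[p]ˣ) :
    evenPow p k (QuotientGroup.mk x) = (x : ℤ_[p]) ^ (2 * k) := rfl

theorem evenPow_zero : evenPow p 0 = 1 := by
  ext y
  obtain ⟨u, rfl⟩ := QuotientGroup.mk_surjective y
  simp [evenPow_mk]

theorem exists_EFun (k : ℕ) : ∃ g : C(UnitsModSign p, ℤ_[p]),
    evenPow p k - ∑ i ∈ Finset.range k, (coef k p i : ℤ_[p]) • evenPow p i =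
      (lead p k : ℤ_[p]) • g := by
  refine exists_smul_eq_of_forall_dvd (Nat.cast_ne_zero.2 (lead_ne_zero p k)) _ fun y => ?_
  obtain ⟨x, rfl⟩ := QuotientGroup.mk_surjective y
  refine ⟨EVal k x, ?_⟩
  rw [lead_mul_EVal]
  simp [evenPow_mk]

/-- The polynomial `E p (2 * k)` as a continuous function on `ℤ_p^* / {± 1}`. -/
def EFun (p : ℕ) [Fact p.Prime] (k : ℕ) : C(UnitsModSign p, ℤ_[p]) := (exists_EFun k).choose

theorem lead_smul_EFun (k : ℕ) : (lead p k : ℤ_[p]) • EFun p k =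
    evenPow p k - ∑ i ∈ Finset.range k, (coef k p i : ℤ_[p]) • evenPow p i :=
  (exists_EFun k).choose_spec.symm

theorem EFun_mk (k : ℕ) (x : ℤ_[p]ˣ) : EFun p k (QuotientGroup.mk x) = EVal k x := by
  refine mul_left_cancel₀ (Nat.cast_ne_zero.2 (lead_ne_zero p k) : (lead p k : ℤ_[p]) ≠ 0) ?_
  rw [lead_mul_EVal]
  have h := DFunLike.congr_fun (lead_smul_EFun (p := p) k) (QuotientGroup.mk x)
  simpa [evenPow_mk] using h

theorem mk_neg (x : ℤ_[p]ˣ) : (QuotientGroup.mk (-x) : UnitsModSign p) = QuotientGroup.mk x := by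
  rw [eq_comm, QuotientGroup.eq]
  have h : x⁻¹ * -x = -1 := by rw [mul_neg, inv_mul_cancel]
  rw [h]
  exact Subgroup.mem_zpowers _

/-- Uniform continuity: on the compact set of pairs with values distinct modulo `p`, the distance
has a positive minimum. -/
theorem exists_pow_dvd_imp_dvd {f : ℤ_[p]ˣ → ℤ_[p]} (hf : Continuous f) :
    ∃ n, ∀ x y : ℤ_[p]ˣ, (p : ℤ_[p]) ^ n ∣ (x : ℤ_[p]) - y → (p : ℤ_[p]) ∣ f x - f y := by
  let Z : Set (ℤ_[p]ˣ × ℤ_[p]ˣ) := {q | ¬ (p : ℤ_[p]) ^ 1 ∣ f q.1 - f q.2}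
  have hZ : IsClosed Z := by
    refine isOpen_compl_iff.1 ?_
    have h1 : Continuous fun q : ℤ_[p]ˣ × ℤ_[p]ˣ => f q.1 - f q.2 :=
      (hf.comp continuous_fst).sub (hf.comp continuous_snd)
    convert (isOpen_setOf_pow_dvd 1).preimage h1 using 1
    ext q
    simp [Z]
  by_cases hne : Z.Nonempty
  · have hc : Continuous fun q : ℤ_[p]ˣ × ℤ_[p]ˣ => ‖(q.1 : ℤ_[p]) - q.2‖ :=
      ((Units.continuous_val.comp continuous_fst).sub
        (Units.continuous_val.comp continuous_snd)).norm
    obtain ⟨q, hq, hmin⟩ := hZ.isCompact.exists_isMinOn hne hc.continuousOn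
    have hpos : 0 < ‖(q.1 : ℤ_[p]) - q.2‖ := by
      rw [norm_pos_iff, sub_ne_zero]
      intro h
      apply hq
      rw [Units.ext h, sub_self]
      exact dvd_zero _
    obtain ⟨n, hn⟩ := PadicInt.exists_pow_neg_lt p hpos
    refine ⟨n, fun x y hxy => ?_⟩
    by_contra hcon
    have h1 : (x, y) ∈ Z := by simpa [Z] using hcon
    have h2 := hmin h1
    rw [← Ideal.mem_span_singleton, ← PadicInt.norm_le_pow_iff_mem_span_pow] at hxy
    exact absurd (hn.trans_le h2) (not_lt.2 hxy)
  · refine ⟨0, fun x y _ => ?_⟩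
    by_contra hcon
    exact hne ⟨(x, y), by simpa [Z] using hcon⟩

theorem exists_lt_halfTotient (p : ℕ) [Fact p.Prime] (N : ℕ) :
    ∃ i, N ≤ i ∧ 2 < p ^ (i + 1) ∧ N < halfTotient p i := by
  have hp : p.Prime := Fact.out
  have h1 : 2 * N + 2 < p ^ (2 * N + 2) := Nat.lt_pow_self hp.one_lt
  have h2 : p ^ (2 * N + 2) ≤ p ^ (2 * N + 2 + 1) := Nat.pow_le_pow_right hp.pos (by omega)
  have h3 : 2 < p ^ (2 * N + 2 + 1) := by omega
  -- Here `p ^ i > i = 2 * N + 2`, which leaves more than `N` after halving.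
  refine ⟨2 * N + 2, by omega, h3, ?_⟩
  have h4 := two_mul_halfTotient hp h3
  have h5 : p ^ (2 * N + 2) ≤ p ^ (2 * N + 2) * (p - 1) :=
    Nat.le_mul_of_pos_right _ (Nat.sub_pos_of_lt hp.one_lt)
  omega

/-- The functions `EFun` span a `p`-adically dense submodule. -/
theorem exists_eq_linearCombination_add_smul (f : C(UnitsModSign p, ℤ_[p])) :
    ∃ (r : ℕ →₀ ℤ_[p]) (g : C(UnitsModSign p, ℤ_[p])),
      f = Finsupp.linearCombination ℤ_[p] (EFun p) r + (p : ℤ_[p]) • g := by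
  obtain ⟨n, hn⟩ := exists_pow_dvd_imp_dvd (f := fun x : ℤ_[p]ˣ => f (QuotientGroup.mk x))
    (f.continuous.comp continuous_quot_mk)
  obtain ⟨i, hni, hi, -⟩ := exists_lt_halfTotient p n
  obtain ⟨r, hr⟩ := exists_sum_EMod_eq hi
    (fun x => PadicInt.toZMod (f (QuotientGroup.mk x))) (fun x => by rw [mk_neg])
    (fun x y hxy => (toZMod_eq_iff _ _).2 (hn x y ((pow_dvd_pow _ (by omega)).trans hxy)))
  let s : ℕ →₀ ℤ_[p] := ∑ k ∈ Finset.range (halfTotient p i),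
    Finsupp.single k (((r k).val : ℕ) : ℤ_[p])
  have hs : Finsupp.linearCombination ℤ_[p] (EFun p) s =
      ∑ k ∈ Finset.range (halfTotient p i), (((r k).val : ℕ) : ℤ_[p]) • EFun p k := by
    simp [s, Finsupp.linearCombination_single]
  obtain ⟨g, hg⟩ := exists_smul_eq_of_forall_dvd
    (Nat.cast_ne_zero.2 hpf.out.ne_zero : (p : ℤ_[p]) ≠ 0)
    (f - Finsupp.linearCombination ℤ_[p] (EFun p) s) (by
      intro y
      obtain ⟨x, rfl⟩ := QuotientGroup.mk_surjective y
      rw [ContinuousMap.sub_apply, ← toZMod_eq_iff, hr x, hs]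
      simp only [ContinuousMap.coe_sum, Finset.sum_apply, ContinuousMap.coe_smul, Pi.smul_apply,
        smul_eq_mul, map_sum, map_mul, EFun_mk, map_natCast, ZMod.natCast_zmod_val]
      rfl)
  exact ⟨s, g, by rw [← hg]; abel⟩

/-- The functions `EFun` are linearly independent modulo `p`. -/
theorem exists_eq_smul_of_linearCombination_eq (r : ℕ →₀ ℤ_[p]) (g : C(UnitsModSign p, ℤ_[p]))
    (h : Finsupp.linearCombination ℤ_[p] (EFun p) r = (p : ℤ_[p]) • g) :
    ∃ r', r = (p : ℤ_[p]) • r' := by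
  obtain ⟨i, -, hi, hN⟩ := exists_lt_halfTotient p (r.support.sup id)
  have hsub : r.support ⊆ Finset.range (halfTotient p i) := fun k hk =>
    Finset.mem_range.2 ((Finset.le_sup (f := id) hk).trans_lt hN)
  have h1 := eq_zero_of_sum_EMod_eq_zero i hi (fun k => PadicInt.toZMod (r k)) (by
    intro x
    have h2 := congrArg PadicInt.toZMod (DFunLike.congr_fun h (QuotientGroup.mk x))
    rw [Finsupp.linearCombination_apply, Finsupp.sum_of_support_subset _ hsub _ (by simp)] at h2
    simp only [ContinuousMap.coe_sum, Finset.sum_apply, ContinuousMap.coe_smul, Pi.smul_apply,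
      smul_eq_mul, map_sum, map_mul, EFun_mk, map_natCast, CharP.cast_eq_zero, zero_mul] at h2
    exact h2)
  have h2 : ∀ k, ∃ c, r k = p * c := by
    intro k
    by_cases hk : k ∈ r.support
    · have h3 := h1 k (Finset.mem_range.1 (hsub hk))
      rw [← map_zero (PadicInt.toZMod (p := p)), toZMod_eq_iff, sub_zero] at h3
      exact h3
    · exact ⟨0, by rw [Finsupp.notMem_support_iff.1 hk, mul_zero]⟩
  choose c hc using h2
  refine ⟨Finsupp.onFinset r.support c fun k hk => ?_, Finsupp.ext fun k => ?_⟩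
  · rw [Finsupp.mem_support_iff, hc]
    exact mul_ne_zero (Nat.cast_ne_zero.2 hpf.out.ne_zero) hk
  · rw [Finsupp.smul_apply, Finsupp.onFinset_apply, smul_eq_mul, hc]

/-- Independence and density modulo `p` are the saturation and density hypotheses of
`exists_extension`, applied to finite combinations of the `EFun`. -/
theorem exists_meas_EFun (γ : ℕ → ℤ_[p]) : ∃ μ : Meas p, ∀ k, μ (EFun p k) = γ k := by
  obtain ⟨μ, hμ⟩ := exists_extension (Finsupp.linearCombination ℤ_[p] (EFun p))
    (Finsupp.linearCombination ℤ_[p] γ) (fun v hv => by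
      refine ContinuousMap.ext fun y => ?_
      have h := DFunLike.congr_fun hv y
      simpa [hpf.out.ne_zero] using h)
    exists_eq_smul_of_linearCombination_eq exists_eq_linearCombination_add_smul
  refine ⟨μ, fun k => ?_⟩
  have h := hμ (Finsupp.single k 1)
  simpa [Finsupp.linearCombination_single] using h

/-! ### Moments -/

theorem lead_dvd_iff (k : ℕ) (z : ℤ_[p]) :
    (lead p k : ℤ_[p]) ∣ z ↔ (p : ℤ_[p]) ^ padicValNat p (lead p k) ∣ z := by
  obtain ⟨m, hm⟩ := (pow_padicValNat_dvd : p ^ padicValNat p (lead p k) ∣ lead p k)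
  have hu : IsUnit (m : ℤ_[p]) := by
    rw [isUnit_iff_toZMod_ne_zero, map_natCast, ne_eq, ZMod.natCast_eq_zero_iff]
    rintro ⟨c, rfl⟩
    refine pow_succ_padicValNat_not_dvd (p := p) (lead_ne_zero p k) ⟨c, ?_⟩
    rw [pow_succ, mul_assoc]
    exact hm
  nth_rewrite 1 [hm]
  rw [Nat.cast_mul, Nat.cast_pow]
  exact hu.mul_right_dvd

theorem pow_dvd_moment (μ : Meas p) (k : ℕ) : (p : ℤ_[p]) ^ padicValNat p (lead p k) ∣
    μ (evenPow p k) - ∑ i ∈ Finset.range k, (coef k p i : ℤ_[p]) * μ (evenPow p i) := by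
  rw [← lead_dvd_iff]
  refine ⟨μ (EFun p k), ?_⟩
  rw [← smul_eq_mul, ← map_smul, lead_smul_EFun, map_sub, map_sum]
  simp only [map_smul, smul_eq_mul]

/-- The quotients by `lead p k` are prescribed as integrals of `EFun p k`, and the moments follow
recursively. For `2 * k < p - 1`, in particular `k = 0`, `lead p k = 1` and no condition arises. -/
theorem exists_meas_of_congruences (β : ℕ → ℤ_[p]) (h : ∀ k, 1 ≤ k → p - 1 ≤ 2 * k →
    (p : ℤ_[p]) ^ padicValNat p (lead p k) ∣
      β k - ∑ i ∈ Finset.range k, (coef k p i : ℤ_[p]) * β i) :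
    ∃ μ : Meas p, ∀ k, μ (evenPow p k) = β k := by
  have h1 : ∀ k, (lead p k : ℤ_[p]) ∣
      β k - ∑ i ∈ Finset.range k, (coef k p i : ℤ_[p]) * β i := by
    intro k
    by_cases hk : p - 1 ≤ 2 * k
    · refine (lead_dvd_iff k _).2 (h k ?_ hk)
      have := hpf.out.one_lt
      omega
    · rw [lead_eq_one (not_le.1 hk), Nat.cast_one]
      exact one_dvd _
  choose γ hγ using h1
  obtain ⟨μ, hμ⟩ := exists_meas_EFun γ
  refine ⟨μ, fun k => ?_⟩
  induction k using Nat.strong_induction_on with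
  | _ k ih =>
    have h2 := congrArg μ (lead_smul_EFun (p := p) k)
    rw [map_smul, hμ, smul_eq_mul, ← hγ, map_sub, map_sum] at h2
    simp only [map_smul, smul_eq_mul] at h2
    rw [Finset.sum_congr rfl fun i hi =>
      congrArg ((coef k p i : ℤ_[p]) * ·) (ih i (Finset.mem_range.1 hi)).symm] at h2
    exact (sub_left_injective h2).symm

/-- Euler's theorem: the integrand is divisible by `p ^ v` at every unit, since `φ(p ^ v)` divides
`φ(n)`. -/
theorem pow_dvd_moment_sub (μ : Meas p) {v n : ℕ} (hv : p ^ v ∣ n) (i m : ℕ) :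
    (p : ℤ_[p]) ^ v ∣ μ (evenPow p (i + m * n.totient)) - μ (evenPow p i) := by
  obtain ⟨g, hg⟩ := exists_smul_eq_of_forall_dvd
    (pow_ne_zero v (Nat.cast_ne_zero.2 hpf.out.ne_zero : (p : ℤ_[p]) ≠ 0))
    (evenPow p (i + m * n.totient) - evenPow p i) (by
      intro y
      obtain ⟨x, rfl⟩ := QuotientGroup.mk_surjective y
      rw [ContinuousMap.sub_apply, evenPow_mk, evenPow_mk, ← toZModPow_eq_zero_iff, map_sub,
        map_pow, map_pow, sub_eq_zero]
      obtain ⟨u, hu⟩ : IsUnit (PadicInt.toZModPow v (x : ℤ_[p])) := x.isUnit.map _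
      obtain ⟨t, ht⟩ := Nat.totient_dvd_of_dvd hv
      have h1 : u ^ n.totient = 1 := by
        rw [ht, pow_mul, ZMod.pow_totient, one_pow]
      have h2 : 2 * (i + m * n.totient) = 2 * i + n.totient * (2 * m) := by ring
      rw [← hu, h2, pow_add, pow_mul (u : ZMod (p ^ v)) n.totient,
        ← Units.val_pow_eq_pow_val u n.totient, h1]
      simp)
  rw [← map_sub, hg, map_smul, smul_eq_mul]
  exact dvd_mul_right _ _

/-! ### Moment sequences and lower parts -/

theorem ZHat.natCast_dvd_of_prime_pow {n : ℕ} (hn : n ≠ 0) {y : ZHat}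
    (h : ∀ p v : ℕ, p.Prime → p ^ v ∣ n → ((p ^ v : ℕ) : ZHat) ∣ y) : (n : ZHat) ∣ y := by
  rw [← Nat.prod_factorization_pow_eq_self hn, Finsupp.prod, Nat.cast_prod]
  refine Finset.prod_dvd_of_coprime (fun p hp q hq hpq => ?_) fun p hp =>
    h p _ (Nat.prime_of_mem_primeFactors hp) (Nat.ordProj_dvd n p)
  exact (Nat.Coprime.pow _ _ ((Nat.coprime_primes (Nat.prime_of_mem_primeFactors hp)
    (Nat.prime_of_mem_primeFactors hq)).2 hpq)).cast

theorem ZHat.eq_of_forall_dvd_sub {x y : ZHat} (h : ∀ n : ℕ, n ≠ 0 → (n : ZHat) ∣ x - y) :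
    x = y := by
  refine ZHat.ext fun n => ?_
  have h1 := (ZHat.natCast_dvd_iff n _).1 (h n n.ne_zero)
  rwa [map_sub, sub_eq_zero] at h1

/-- The term of index `2 * k` of a sequence starting at the index `2 * m`. -/
def evenPart {m : ℕ} (b : Set.Ici (2 * m) → ℤ) (k : ℕ) : ℤ :=
  if h : m ≤ k then b ⟨2 * k, Set.mem_Ici.2 (by omega)⟩ else 0

theorem evenPart_of_le {m : ℕ} (b : Set.Ici (2 * m) → ℤ) {k : ℕ} (h : m ≤ k) :
    evenPart b k = b ⟨2 * k, Set.mem_Ici.2 (by omega)⟩ := dif_pos h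

theorem extendSeq_of_le {m : ℕ} (a : Fin (2 * m) → ZHat) (b : Set.Ici (2 * m) → ℤ) {k : ℕ}
    (h : m ≤ k) : extendSeq m a b (2 * k) = (evenPart b k : ZHat) := by
  rw [extendSeq, dif_neg (by omega), evenPart_of_le b h]

theorem le_add_mul_totient {m n : ℕ} (hn : n ≠ 0) (i : ℕ) : m ≤ i + m * n.totient :=
  (Nat.le_mul_of_pos_right m (Nat.totient_pos.2 (Nat.pos_of_ne_zero hn))).trans
    (Nat.le_add_left _ _)

/-- The sequences `x` of profinite integers such that, for every `p`, the `p`-adic components are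
the moments of a measure. -/
def IsMomentSeq (x : ℕ → ZHat) : Prop :=
  ∀ (p : ℕ) [Fact p.Prime], ∃ μ : Meas p, ∀ k, μ (evenPow p k) = ZHat.toPadicInt p (x k)

theorem isMomentSeq_iff_congruences (x : ℕ → ZHat) :
    IsMomentSeq (fun k => x (2 * k)) ↔ Congruences x := by
  have key : ∀ (p : ℕ) [Fact p.Prime] (k : ℕ), ((p ^ padicValNat p (lead p k) : ℕ) : ZHat) ∣
      x (2 * k) - ∑ i ∈ Finset.range k, (coef k p i : ZHat) * x (2 * i) ↔
      (p : ℤ_[p]) ^ padicValNat p (lead p k) ∣ ZHat.toPadicInt p (x (2 * k)) -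
        ∑ i ∈ Finset.range k, (coef k p i : ℤ_[p]) * ZHat.toPadicInt p (x (2 * i)) := by
    intro p _ k
    rw [ZHat.pow_dvd_iff, map_sub, map_sum]
    simp only [map_mul, map_intCast]
  constructor
  · intro h k _ p hp _
    have : Fact p.Prime := ⟨hp⟩
    obtain ⟨μ, hμ⟩ := h p
    rw [key]
    simp only [← hμ]
    exact pow_dvd_moment μ k
  · intro h p hp
    exact exists_meas_of_congruences _ fun k hk hpk => (key p k).1 (h k hk p hp.out hpk)

theorem IsMomentSeq.natCast_dvd_sub {x : ℕ → ZHat} (hx : IsMomentSeq x) {n : ℕ} (hn : n ≠ 0)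
    (i m : ℕ) : (n : ZHat) ∣ x (i + m * n.totient) - x i := by
  refine ZHat.natCast_dvd_of_prime_pow hn fun p v hp hv => ?_
  have : Fact p.Prime := ⟨hp⟩
  obtain ⟨μ, hμ⟩ := hx p
  rw [ZHat.pow_dvd_iff, map_sub, ← hμ, ← hμ]
  exact pow_dvd_moment_sub μ hv i m

/-- The component of `x i` at level `n` is `b_{2(i + mφ(n))}`, whose index lies in the given range.
For each `p^v ∣ n` it agrees modulo `p ^ v` with the `i`-th even moment of a measure, which gives
compatibility in `n` and identifies the `p`-adic components. -/
theorem exists_isMomentSeq {m : ℕ} {b : Set.Ici (2 * m) → ℤ} (hb : b ∈ Mom m) :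
    ∃ x : ℕ → ZHat, IsMomentSeq x ∧ x 0 = 0 ∧ ∀ k, m ≤ k → x k = (evenPart b k : ZHat) := by
  have hμ : ∀ (p : ℕ) [Fact p.Prime], ∃ μ : Meas p,
      (∀ k, m ≤ k → (evenPart b k : ℤ_[p]) = μ (evenPow p k)) ∧ μ (evenPow p 0) = 0 := by
    intro p _
    obtain ⟨μ, h1, h2⟩ := hb.2 p
    exact ⟨μ, fun k hk => by rw [evenPart_of_le b hk, h1 k hk], by rw [evenPow_zero, h2]⟩
  have hcompat : ∀ i d n : ℕ, n ≠ 0 → d ∣ n → (d : ZHat) ∣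
      ((evenPart b (i + m * n.totient) : ℤ) : ZHat) - (evenPart b (i + m * d.totient) : ℤ) := by
    intro i d n hn hd
    have hd0 : d ≠ 0 := ne_zero_of_dvd_ne_zero hn hd
    refine ZHat.natCast_dvd_of_prime_pow hd0 fun p v hp hv => ?_
    have : Fact p.Prime := ⟨hp⟩
    obtain ⟨μ, h1, -⟩ := hμ p
    rw [ZHat.pow_dvd_iff, map_sub, map_intCast, map_intCast, h1 _ (le_add_mul_totient hn i),
      h1 _ (le_add_mul_totient hd0 i)]
    have h3 := dvd_sub (pow_dvd_moment_sub μ (hv.trans hd) i m) (pow_dvd_moment_sub μ hv i m)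
    rwa [sub_sub_sub_cancel_right] at h3
  let x : ℕ → ZHat := fun i => ⟨fun n => ((evenPart b (i + m * (n : ℕ).totient) : ℤ) : ZMod n), by
    intro d n hd
    have h1 := (ZHat.natCast_dvd_iff d _).1 (hcompat i d n n.ne_zero hd)
    rw [map_sub, map_intCast, map_intCast, sub_eq_zero] at h1
    rw [map_intCast, h1]⟩
  have hx : ∀ (i n : ℕ), n ≠ 0 →
      (n : ZHat) ∣ ((evenPart b (i + m * n.totient) : ℤ) : ZHat) - x i := by
    intro i n hn
    refine (ZHat.natCast_dvd_iff ⟨n, Nat.pos_of_ne_zero hn⟩ _).2 ?_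
    rw [map_sub, map_intCast, sub_eq_zero]
    rfl
  have hxμ : ∀ (p : ℕ) [Fact p.Prime] (μ : Meas p),
      (∀ k, m ≤ k → (evenPart b k : ℤ_[p]) = μ (evenPow p k)) →
      ∀ k, μ (evenPow p k) = ZHat.toPadicInt p (x k) := by
    intro p hp μ h1 k
    refine eq_of_forall_pow_dvd_sub fun v => ?_
    have hv0 : p ^ v ≠ 0 := pow_ne_zero _ hp.out.ne_zero
    have h2 := (ZHat.pow_dvd_iff p v _).1 (hx k (p ^ v) hv0)
    rw [map_sub, map_intCast, h1 _ (le_add_mul_totient hv0 k)] at h2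
    have h3 := dvd_sub h2 (pow_dvd_moment_sub μ dvd_rfl k m)
    rwa [sub_sub_sub_cancel_left] at h3
  have hxm : IsMomentSeq x := by
    intro p _
    obtain ⟨μ, h1, -⟩ := hμ p
    exact ⟨μ, hxμ p μ h1⟩
  refine ⟨x, hxm, ?_, ?_⟩
  · refine ZHat.eq_of_forall_dvd_sub fun n hn => ZHat.natCast_dvd_of_prime_pow hn
      fun p v hp _ => ?_
    have : Fact p.Prime := ⟨hp⟩
    obtain ⟨μ, h1, h2⟩ := hμ p
    rw [sub_zero, ZHat.pow_dvd_iff, ← hxμ p μ h1, h2]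
    exact dvd_zero _
  · intro k hk
    refine ZHat.eq_of_forall_dvd_sub fun n hn => ZHat.natCast_dvd_of_prime_pow hn
      fun p v hp _ => ?_
    have : Fact p.Prime := ⟨hp⟩
    obtain ⟨μ, h1, h2⟩ := hμ p
    rw [ZHat.pow_dvd_iff, map_sub, ← hxμ p μ h1, map_intCast, h1 k hk, sub_self]
    exact dvd_zero _

theorem mem_Mom_of_isLowerPart {m : ℕ} (hm : 1 ≤ m) {b : Set.Ici (2 * m) → ℤ}
    (hodd : ∀ (k : ℕ) (hk : m ≤ k), b ⟨2 * k + 1, Set.mem_Ici.2 (by omega)⟩ = 0)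
    {a : Fin (2 * m) → ZHat} (ha : IsLowerPart m b a) : b ∈ Mom m := by
  refine ⟨hodd, fun p _ => ?_⟩
  obtain ⟨μ, hμ⟩ := (isMomentSeq_iff_congruences _).2 ha.2.2 p
  beta_reduce at hμ
  refine ⟨μ, fun k hk => ?_, ?_⟩
  · rw [hμ, extendSeq_of_le a b hk, evenPart_of_le b hk, map_intCast]
  · rw [← evenPow_zero, hμ, extendSeq, dif_pos (by omega)]
    exact (congrArg _ (ha.1 (by omega))).trans (map_zero _)

theorem isLowerPart_of_seq {m : ℕ} {b : Set.Ici (2 * m) → ℤ} {x : ℕ → ZHat}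
    (hx : Congruences fun k => x (k / 2)) (h0 : x 0 = 0)
    (hb : ∀ k, m ≤ k → x k = (evenPart b k : ZHat)) :
    IsLowerPart m b fun i => if Even i.1 then x (i.1 / 2) else 0 := by
  refine ⟨fun h => by simpa using h0, fun i h => ?_, ?_⟩
  · exact if_neg (by simp [parity_simps])
  · have h1 : ∀ k, extendSeq m (fun i => if Even i.1 then x (i.1 / 2) else 0) b (2 * k) =
        x (2 * k / 2) := by
      intro k
      rw [Nat.mul_div_cancel_left _ two_pos]
      by_cases hk : m ≤ k
      · rw [extendSeq_of_le _ _ hk, hb k hk]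
      · rw [extendSeq, dif_pos (by omega)]
        simp
    intro k hk p hp hpk
    simp only [h1]
    exact hx k hk p hp hpk

/-- Modulo each `n`, a lower term equals a term of `b` far enough out, which does not depend on the
choice. -/
theorem isLowerPart_unique {m : ℕ} {b : Set.Ici (2 * m) → ℤ} {a a' : Fin (2 * m) → ZHat}
    (ha : IsLowerPart m b a) (ha' : IsLowerPart m b a') : a = a' := by
  have key : ∀ {a : Fin (2 * m) → ZHat}, IsLowerPart m b a → ∀ (i n : ℕ), n ≠ 0 →
      (n : ZHat) ∣ ((evenPart b (i + m * n.totient) : ℤ) : ZHat) - extendSeq m a b (2 * i) := by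
    intro a ha i n hn
    have h1 := ((isMomentSeq_iff_congruences _).2 ha.2.2).natCast_dvd_sub hn i m
    rwa [extendSeq_of_le a b (le_add_mul_totient hn i)] at h1
  funext ⟨j, hj⟩
  rcases Nat.even_or_odd' j with ⟨i, rfl | rfl⟩
  · have h1 : extendSeq m a b (2 * i) = extendSeq m a' b (2 * i) := by
      refine ZHat.eq_of_forall_dvd_sub fun n hn => ?_
      have h2 := dvd_sub (key ha' i n hn) (key ha i n hn)
      rwa [sub_sub_sub_cancel_left] at h2
    rwa [extendSeq, extendSeq, dif_pos hj, dif_pos hj] at h1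
  · rw [ha.2.1 i (by omega), ha'.2.1 i (by omega)]

theorem exists_isLowerPart {m : ℕ} {b : Set.Ici (2 * m) → ℤ} (hb : b ∈ Mom m) :
    ∃ a, IsLowerPart m b a := by
  obtain ⟨x, hx, h0, hxb⟩ := exists_isMomentSeq hb
  refine ⟨_, isLowerPart_of_seq ((isMomentSeq_iff_congruences _).1 ?_) h0 hxb⟩
  simpa using hx

/-! ### The explicit map -/

theorem evenTerm_zero (m : ℕ) (l : Param m) : evenTerm m l 0 = 0 := by
  rw [evenTerm, dif_neg (by omega)]

theorem evenTerm_of_lt {m : ℕ} (l : Param m) {k : ℕ} (hk : 1 ≤ k) (h : k < m) :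
    evenTerm m l k = (residue k (fun i : Fin k => evenTerm m l i) : ZHat) +
      l.1 ⟨k, hk, h⟩ * (modulus k : ZHat) := by
  rw [evenTerm, dif_pos hk, dif_pos h]

theorem evenPart_Psi {m : ℕ} (l : Param m) {k : ℕ} (hk : m ≤ k) :
    evenPart (Psi m l) k = (residue k (fun i : Fin k => evenTerm m l i) : ℤ) +
      l.2 ⟨k, hk⟩ * (modulus k : ℤ) := by
  have h2 : ∀ j (_ : j = k) (h : m ≤ j),
      ((residue j (fun i => evenTerm m l i) : ℤ) +
        l.2 ⟨j, Set.mem_Ici.2 h⟩ * (modulus j : ℤ) : ℤ) =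
      (residue k (fun i => evenTerm m l i) : ℤ) +
        l.2 ⟨k, Set.mem_Ici.2 hk⟩ * (modulus k : ℤ) := by
    rintro j rfl h
    rfl
  rw [evenPart_of_le _ hk, Psi, if_pos (even_two_mul k), h2 _ (by simp) (by simpa using hk)]

theorem evenTerm_of_le {m : ℕ} (hm : 1 ≤ m) (l : Param m) {k : ℕ} (hk : m ≤ k) :
    evenTerm m l k = (evenPart (Psi m l) k : ZHat) := by
  rw [evenPart_of_le _ hk, Psi_even_cast hm l k hk]

theorem modulus_dvd_evenTerm_sub {m : ℕ} (l : Param m) {k : ℕ} (hk : 1 ≤ k) :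
    (modulus k : ZHat) ∣
      evenTerm m l k - (residue k (fun i : Fin k => evenTerm m l i) : ZHat) := by
  rw [evenTerm, dif_pos hk, add_sub_cancel_left]
  exact dvd_mul_left _ _

theorem congruences_evenTerm {m : ℕ} (l : Param m) :
    Congruences fun k => evenTerm m l (k / 2) := by
  intro k hk p hp hpk
  have hmem : p ∈ primesUpTo k := mem_primesUpTo.2 ⟨hp, hpk⟩
  have h1 := (residue_spec k (fun i : Fin k => evenTerm m l i)).2 p hmem
  have h2 := (Nat.cast_dvd_cast (α := ZHat) (pow_dvd_modulus hmem)).trans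
    (modulus_dvd_evenTerm_sub l hk)
  have h3 := dvd_add h2 h1
  rw [sub_add_sub_cancel] at h3
  simp only [Nat.mul_div_cancel_left _ two_pos]
  rwa [Finset.sum_range]

theorem isLowerPart_Psi {m : ℕ} (hm : 1 ≤ m) (l : Param m) :
    IsLowerPart m (Psi m l) fun i => if Even i.1 then evenTerm m l (i.1 / 2) else 0 :=
  isLowerPart_of_seq (congruences_evenTerm l) (evenTerm_zero m l) fun _ hk =>
    evenTerm_of_le hm l hk

theorem Psi_odd {m : ℕ} (l : Param m) (k : ℕ) (hk : m ≤ k) :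
    Psi m l ⟨2 * k + 1, Set.mem_Ici.2 (by omega)⟩ = 0 :=
  if_neg (by simp [parity_simps])

theorem Psi_mem_Mom {m : ℕ} (hm : 1 ≤ m) (l : Param m) : Psi m l ∈ Mom m :=
  mem_Mom_of_isLowerPart hm (Psi_odd l) (isLowerPart_Psi hm l)

/-- Equal images have equal lower parts by uniqueness, hence equal residues; `l_k` is then recovered
by cancelling the modulus, as `ZHat` and `ℤ` have no torsion. -/
theorem Psi_injective {m : ℕ} (hm : 1 ≤ m) : Function.Injective (Psi m) := by
  intro l l' hl
  have h1 := isLowerPart_Psi hm l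
  rw [hl] at h1
  have h2 := isLowerPart_unique h1 (isLowerPart_Psi hm l')
  have h3 : evenTerm m l = evenTerm m l' := by
    funext k
    by_cases hk : m ≤ k
    · rw [evenTerm_of_le hm l hk, evenTerm_of_le hm l' hk, hl]
    · have h4 := congrFun h2 ⟨2 * k, by omega⟩
      simpa using h4
  refine Prod.ext (funext ?_) (funext ?_)
  · rintro ⟨k, hk1, hkm⟩
    have h4 := evenTerm_of_lt l hk1 hkm
    rw [h3, evenTerm_of_lt l' hk1 hkm, add_right_inj] at h4
    refine (sub_eq_zero.1 (ZHat.eq_zero_of_natCast_mul (modulus_pos k).ne' ?_)).symm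
    rw [mul_comm, sub_mul, h4, sub_self]
  · rintro ⟨k, hk⟩
    have h4 := evenPart_Psi l hk
    rw [hl, evenPart_Psi l' hk, h3, add_right_inj] at h4
    exact (mul_right_cancel₀ (Nat.cast_ne_zero.2 (modulus_pos k).ne') h4).symm

/-- The parameter `l_k` is the quotient of `b_{2k}` minus its residue by the modulus; for `k ≥ m`
the divisibility in `ZHat` descends to `ℤ`. -/
theorem exists_Psi_eq {m : ℕ} (hm : 1 ≤ m) {b : Set.Ici (2 * m) → ℤ} (hb : b ∈ Mom m) :
    ∃ l, Psi m l = b := by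
  obtain ⟨x, hx, h0, hxb⟩ := exists_isMomentSeq hb
  have hc : Congruences fun k => x (k / 2) := (isMomentSeq_iff_congruences _).1 (by simpa using hx)
  have hdvd : ∀ k, 1 ≤ k →
      (modulus k : ZHat) ∣ x k - (residue k (fun i : Fin k => x i) : ZHat) := by
    intro k hk
    refine modulus_dvd fun p hp => ?_
    have h1 := (residue_spec k (fun i : Fin k => x i)).2 p hp
    have h2 := hc k hk p (mem_primesUpTo.1 hp).1 (mem_primesUpTo.1 hp).2
    simp only [Nat.mul_div_cancel_left _ two_pos] at h2
    rw [Finset.sum_range] at h2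
    have h3 := dvd_sub h2 h1
    rwa [sub_sub_sub_cancel_right] at h3
  have hdvdZ : ∀ k, m ≤ k → (modulus k : ℤ) ∣
      evenPart b k - (residue k (fun i : Fin k => x i) : ℤ) := by
    intro k hk
    refine ZHat.intCast_dvd_intCast (n := ⟨modulus k, modulus_pos k⟩) ?_
    have h1 := hdvd k (hm.trans hk)
    rw [hxb k hk] at h1
    push_cast
    exact h1
  choose l₁ hl₁ using hdvd
  choose l₂ hl₂ using hdvdZ
  let l : Param m := (fun k => l₁ k.1 k.2.1, fun k => l₂ k.1 k.2)
  have key : ∀ k, evenTerm m l k = x k := by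
    intro k
    induction k using Nat.strong_induction_on with
    | _ k ih =>
      have hr : (fun i : Fin k => evenTerm m l i) = fun i : Fin k => x i :=
        funext fun i => ih i i.2
      rcases Nat.eq_zero_or_pos k with rfl | hk
      · rw [evenTerm_zero, h0]
      · by_cases hkm : k < m
        · rw [evenTerm_of_lt l hk hkm, hr, sub_eq_iff_eq_add'.1 (hl₁ k hk), mul_comm]
        · rw [evenTerm_of_le hm l (not_lt.1 hkm), evenPart_Psi l (not_lt.1 hkm), hr,
            hxb k (not_lt.1 hkm), sub_eq_iff_eq_add'.1 (hl₂ k (not_lt.1 hkm)), mul_comm]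
  refine ⟨l, funext ?_⟩
  rintro ⟨j, hj⟩
  have hj' : 2 * m ≤ j := hj
  rcases Nat.even_or_odd' j with ⟨k, rfl | rfl⟩
  · have hk : m ≤ k := by omega
    have h1 := evenPart_Psi l hk
    have hr : (fun i : Fin k => evenTerm m l i) = fun i : Fin k => x i := funext fun i => key i
    rw [hr, mul_comm, ← sub_eq_iff_eq_add'.1 (hl₂ k hk), evenPart_of_le _ hk,
      evenPart_of_le _ hk] at h1
    exact h1
  · have hk : m ≤ k := by omega
    rw [Psi_odd l k hk, hb.1 k hk]

theorem Psi_not_additive {m : ℕ} (hm : 1 ≤ m) :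
    ¬ ∀ l l' : Param m, Psi m (l + l') = Psi m l + Psi m l' := by
  classical
  intro hadd
  let l : Param m := (0, Pi.single ⟨m, Set.mem_Ici.2 le_rfl⟩ 1)
  have h0 : Psi m 0 = 0 := by simpa using hadd 0 0
  have h1 : Psi m l + Psi m (-l) = 0 := by rw [← hadd, add_neg_cancel, h0]
  have hne : ∀ k (hk : m < k), l.2 ⟨k, Set.mem_Ici.2 hk.le⟩ = 0 := by
    intro k hk
    refine Pi.single_eq_of_ne (fun h => ?_) _
    exact hk.ne' (congrArg Subtype.val h)
  have h2 : ∀ k, m < k → evenPart (Psi m l) k = 0 := by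
    intro k hk
    have h3 := evenPart_Psi l hk.le
    have h4 := evenPart_Psi (-l) hk.le
    -- Beyond `m` the parameters of `l` and `-l` vanish, so both terms are bare residues; being
    -- nonnegative with sum zero, they are zero.
    rw [hne k hk] at h3
    rw [Prod.snd_neg, Pi.neg_apply, hne k hk] at h4
    have h5 : evenPart (Psi m l) k + evenPart (Psi m (-l)) k = 0 := by
      rw [evenPart_of_le _ hk.le, evenPart_of_le _ hk.le]
      exact congrFun h1 _
    rw [h3, h4] at h5
    rw [h3]
    omega
  have h3 : 0 < evenPart (Psi m l) m := by
    rw [evenPart_Psi l le_rfl]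
    have h4 : l.2 ⟨m, Set.mem_Ici.2 le_rfl⟩ = 1 := Pi.single_eq_same _ _
    have h5 := modulus_pos m
    rw [h4]
    omega
  obtain ⟨x, hx, -, hxb⟩ := exists_isMomentSeq (Psi_mem_Mom hm l)
  obtain ⟨c, hc⟩ := Int.eq_ofNat_of_zero_le h3.le
  -- With `c = b_{2m} > 0`, the modulus `c + 1` would divide `c`, because the later term it is
  -- compared with is zero.
  have h4 := hx.natCast_dvd_sub (Nat.succ_ne_zero c) m m
  have h5 : m < m + m * (c + 1).totient :=
    Nat.lt_add_of_pos_right (mul_pos hm (Nat.totient_pos.2 (Nat.succ_pos c)))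
  rw [hxb m le_rfl, hxb _ h5.le, h2 _ h5, Int.cast_zero, zero_sub, dvd_neg] at h4
  have h6 := ZHat.intCast_dvd_intCast (n := ⟨c + 1, Nat.succ_pos c⟩) h4
  have h7 := Int.le_of_dvd h3 h6
  rw [hc] at h7
  simp only [PNat.mk_coe] at h7
  omega

end PMoment

end

theorem mainTheorem7 (m : ℕ) (hm : 1 ≤ m) :
    (∀ b : Set.Ici (2 * m) → ℤ,
      (∀ (k : ℕ) (hk : m ≤ k), b ⟨2 * k + 1, Set.mem_Ici.2 (by omega)⟩ = 0) →
        (b ∈ PMoment.Mom m ↔ ∃ a : Fin (2 * m) → PMoment.ZHat, PMoment.IsLowerPart m b a) ∧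
        (∀ a a' : Fin (2 * m) → PMoment.ZHat,
          PMoment.IsLowerPart m b a → PMoment.IsLowerPart m b a' → a = a')) ∧
    (∀ k : ℕ, 1 ≤ k → ∀ x : Fin k → PMoment.ZHat, ∃! r : ℕ, PMoment.IsResidue k x r) ∧
    Set.BijOn (PMoment.Psi m) Set.univ (PMoment.Mom m) ∧
    ¬ (∀ l l' : PMoment.Param m,
      PMoment.Psi m (l + l') = PMoment.Psi m l + PMoment.Psi m l') := by
  refine ⟨fun b hodd => ⟨⟨PMoment.exists_isLowerPart, fun ⟨_, ha⟩ =>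
      PMoment.mem_Mom_of_isLowerPart hm hodd ha⟩,
      fun _ _ => PMoment.isLowerPart_unique⟩,
    fun k _ => PMoment.existsUnique_isResidue k, ⟨fun l _ => PMoment.Psi_mem_Mom hm l,
      (PMoment.Psi_injective hm).injOn, fun b hb => ?_⟩, PMoment.Psi_not_additive hm⟩
  obtain ⟨l, hl⟩ := PMoment.exists_Psi_eq hm hb
  exact ⟨l, Set.mem_univ l, hl⟩
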